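/- Let $\alpha,\beta\ge 0$ and $0<\tau<1$, and set $\eta_1=\alpha+1+\tau$ and $\eta_2=\max(2\beta+\alpha-1+\tau,\,0)$. Then there is a constant $C=C(\alpha,\beta,\tau)>0$, depending only on $\alpha,\beta,\tau$, such that the following holds. Let $K_0\in\mathbb R$ and let $g:\mathbb C\setminus[-2,2]\to\mathbb C$ be holomorphic with $\lim_{|\lambda|\to\infty}g(\lambda)=1$ and $$\log|g(\lambda)|\le\frac{K_0}{\operatorname{dist}(\lambda,[-2,2])^{\alpha}\,|\lambda^2-4|^{\beta}}\qquad(\lambda\in\mathbb C\setminus[-2,2]),$$ where $\log 0=-\infty$. Then $$\sum_{\lambda\in\mathbb C\setminus[-2,2],\;g(\lambda)=0}\frac{\operatorname{dist}(\lambda,[-2,2])^{\eta_1}}{|\lambda^2-4|^{(\eta_1-\eta_2)/2}}\le C(\alpha,\beta,\tau)\,K_0,$$ where each zero of $g$ is counted according to its multiplicity. -/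

import Mathlib

open scoped ENNReal Topology

/-- The real segment `[-2,2]`, viewed as a subset of the complex plane. -/
def cutSegment : Set ℂ := (fun x : ℝ => (x : ℂ)) '' Set.Icc (-2) 2

/-- The distance of `z` to the segment `[-2,2]`. -/
noncomputable def distCut (z : ℂ) : ℝ := Metric.infDist z cutSegment

/-- The exponent `η₁ = α + 1 + τ`. -/
noncomputable def etaOne (α τ : ℝ) : ℝ := α + 1 + τ

/-- The exponent `η₂ = (2β + α - 1 + τ)₊`. -/
noncomputable def etaTwo (α β τ : ℝ) : ℝ := max (2 * β + α - 1 + τ) 0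

/-- The sum over the zeros `z` of `g` off `[-2,2]`, counted with multiplicity, of
`dist(z,[-2,2])^η₁ / |z² - 4|^((η₁ - η₂)/2)`, as an extended nonnegative number. -/
noncomputable def zeroSum (g : ℂ → ℂ) (η₁ η₂ : ℝ) : ℝ≥0∞ :=
  ∑' z : {z : ℂ // z ∉ cutSegment ∧ g z = 0},
    ((analyticOrderAt g (z : ℂ) : ℕ∞) : ℝ≥0∞) *
      ENNReal.ofReal (distCut z ^ η₁ / ‖(z : ℂ) ^ 2 - 4‖ ^ ((η₁ - η₂) / 2))

/-! ### The Joukowski map and distances to the segment -/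

section Joukowski

/-! Pull `g` back to the unit disc by `λ = z + z⁻¹` and put `v = z⁻¹ - z`. Then `|λ² - 4| = |v|²`,
and `dist(λ, [-2,2])` is comparable to `(1 - |z|) |v|`. So the pullback is `1` at the origin, its
logarithm is at most a constant times `K₀ (1 - |z|)^(-α) |v|^(-γ)` with `γ = α + 2β`, and the weight
of a zero is at most a constant times `(1 - |z|)^(α + 1 + τ) |v|^b` with `b = η₂ = max(γ - 1 + τ,
0)`.

Jensen's formula on circles about the origin cannot be used directly, since `|v|^(-γ)` may fail to
be integrable near `z = ±1`. Instead remove `|v| ≤ s`. What remains is the image of the disc under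
an explicit map `dumbbellMap s`, given by `v - s²/v = (1 + s²/4)(ζ⁻¹ - ζ)`. There `|v| ≥ s` and `|v|
≥ |1 - ζ²|/2`, so `|v|^(-γ)` is at most `s^(-b)` times a multiple of `Re (1 - ζ²)^(-(1-τ))`, a
harmonic function with mean `1` on every circle (`rpow_neg_le_mul_re_cpow`,
`circleAverage_re_one_sub_sq_cpow`). Jensen on `|ζ| = 1 - ε` then costs `K₀ ε^(-α) s^(-b)`.

A zero with `|z| > 1/2` is assigned to dyadic `ε ≈ 1 - |z|` and `s ≈ |v|`. By
`exists_dumbbellMap_eq` its preimage satisfies `1 - |ζ| ≥ (1 - |z|)/4`, so Jensen controls it. The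
spare exponent `τ`, split between `ε` and `s`, makes the double dyadic series converge. Zeros with
`|z| ≤ 1/2` are handled by Jensen on circles of radius `3/4 · 2⁻ⁿ`. -/

theorem joukowski_sq_sub_four {z : ℂ} (hz : z ≠ 0) :
    (z + z⁻¹) ^ 2 - 4 = (z⁻¹ - z) ^ 2 := by
  field_simp; ring

theorem norm_joukowski_sq_sub_four {z : ℂ} (hz : z ≠ 0) :
    ‖(z + z⁻¹) ^ 2 - 4‖ = ‖z⁻¹ - z‖ ^ 2 := by
  rw [joukowski_sq_sub_four hz, norm_pow]

theorem exists_unit_add_inv_eq {x : ℝ} (hx : x ∈ Set.Icc (-2 : ℝ) 2) :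
    ∃ u : ℂ, ‖u‖ = 1 ∧ u + u⁻¹ = x := by
  have hc : Real.cos (Real.arccos (x / 2)) = x / 2 :=
    Real.cos_arccos (by linarith [hx.1]) (by linarith [hx.2])
  refine ⟨Complex.exp (Real.arccos (x / 2) * Complex.I), Complex.norm_exp_ofReal_mul_I _, ?_⟩
  rw [← Complex.exp_neg, ← neg_mul, ← Complex.two_cos, ← Complex.ofReal_cos, hc]
  push_cast; ring

theorem unit_add_inv_mem_cutSegment {u : ℂ} (hu : ‖u‖ = 1) : u + u⁻¹ ∈ cutSegment := by
  refine ⟨2 * u.re, ?_, ?_⟩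
  · have := abs_le.mp (Complex.abs_re_le_norm u)
    rw [hu] at this
    constructor <;> linarith [this.1, this.2]
  · rw [Complex.inv_eq_conj hu, Complex.add_conj]

theorem joukowski_sub {z u : ℂ} (hz : z ≠ 0) (hu : u ≠ 0) :
    z + z⁻¹ - (u + u⁻¹) = (z - u) * (z - u⁻¹) / z := by
  field_simp; ring

theorem inv_sub_self_eq {z : ℂ} (hz : z ≠ 0) : z⁻¹ - z = (1 - z ^ 2) / z := by
  field_simp

theorem cutSegment_nonempty : cutSegment.Nonempty := ⟨_, 0, by norm_num, rfl⟩

theorem isClosed_cutSegment : IsClosed cutSegment :=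
  (isCompact_Icc.image Complex.continuous_ofReal).isClosed

/-- For `|u| = 1` the difference `λ - (u + u⁻¹)` is `(z - u)(z - u⁻¹)/z`. Both factors have modulus
at least `1 - |z|`, and for `|z| < 1` the larger is at least `|1 - z²|/2`, because `1 - z²` is a
combination of the two. -/
theorem le_distCut_joukowski {z : ℂ} (hz : z ≠ 0) :
    (1 - ‖z‖) * ‖z⁻¹ - z‖ / 2 ≤ distCut (z + z⁻¹) := by
  refine (Metric.le_infDist cutSegment_nonempty).2 ?_
  rintro _ ⟨x, hx, rfl⟩
  obtain ⟨u, hu, hux⟩ := exists_unit_add_inv_eq hx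
  have hu0 : u ≠ 0 := by rintro rfl; simp at hu
  have hui : ‖u⁻¹‖ = 1 := by rw [norm_inv, hu, inv_one]
  simp only []
  rw [dist_eq_norm, ← hux, joukowski_sub hz hu0, inv_sub_self_eq hz, norm_div, norm_div, norm_mul]
  have hq : 0 < ‖z‖ := norm_pos_iff.2 hz
  rw [mul_div_assoc', div_div, mul_comm ‖z‖ 2, ← div_div]
  gcongr
  have h1 : 1 - ‖z‖ ≤ ‖z - u‖ := by
    have := norm_sub_norm_le u z; rw [hu, norm_sub_rev] at this; exact this
  have h2 : 1 - ‖z‖ ≤ ‖z - u⁻¹‖ := by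
    have := norm_sub_norm_le u⁻¹ z; rw [hui, norm_sub_rev] at this; exact this
  have h3 : ‖1 - z ^ 2‖ ≤ ‖z - u‖ * ‖z‖ + ‖z - u⁻¹‖ := by
    have : 1 - z ^ 2 = -((z - u) * z + u * (z - u⁻¹)) := by field_simp; ring
    rw [this, norm_neg]
    refine (norm_add_le _ _).trans ?_
    rw [norm_mul, norm_mul, hu, one_mul]
  rcases le_or_gt 1 ‖z‖ with h | h
  · have : (1 - ‖z‖) * ‖1 - z ^ 2‖ ≤ 0 :=
      mul_nonpos_of_nonpos_of_nonneg (by linarith) (norm_nonneg _)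
    have h4 : 0 ≤ ‖z - u‖ * ‖z - u⁻¹‖ := by positivity
    linarith
  · have h5 : ‖1 - z ^ 2‖ ≤ ‖z - u‖ + ‖z - u⁻¹‖ := by
      nlinarith [norm_nonneg (z - u)]
    nlinarith [mul_le_mul_of_nonneg_left h5 (by linarith : (0:ℝ) ≤ 1 - ‖z‖),
      mul_le_mul_of_nonneg_left h1 (norm_nonneg (z - u⁻¹)),
      mul_le_mul_of_nonneg_left h2 (norm_nonneg (z - u))]

theorem one_sub_sq_le_norm (z : ℂ) : 1 - ‖z‖ ^ 2 ≤ ‖1 - z ^ 2‖ := by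
  have := norm_sub_norm_le (1 : ℂ) (z ^ 2)
  rwa [norm_one, norm_pow] at this

theorem norm_inv_sub_self_pos {z : ℂ} (hz : z ≠ 0) (hz1 : ‖z‖ < 1) : 0 < ‖z⁻¹ - z‖ := by
  rw [inv_sub_self_eq hz, norm_div]
  have := one_sub_sq_le_norm z
  have hq : 0 < ‖z‖ := norm_pos_iff.2 hz
  have : 0 < ‖1 - z ^ 2‖ := by nlinarith
  positivity

theorem joukowski_notMem_cutSegment {z : ℂ} (hz : z ≠ 0) (hz1 : ‖z‖ < 1) :
    z + z⁻¹ ∉ cutSegment := by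
  intro h
  have h1 := le_distCut_joukowski hz
  rw [distCut, Metric.infDist_zero_of_mem h] at h1
  have := norm_inv_sub_self_pos hz hz1
  have : 0 < (1 - ‖z‖) * ‖z⁻¹ - z‖ / 2 := by
    have : 0 < 1 - ‖z‖ := by linarith
    positivity
  linarith

/-- The distances from `λ` to the endpoints `±2` have product `|λ² - 4| = |v|²`. -/
theorem distCut_joukowski_le {z : ℂ} (hz : z ≠ 0) : distCut (z + z⁻¹) ≤ ‖z⁻¹ - z‖ := by
  have h2 : distCut (z + z⁻¹) ≤ ‖z + z⁻¹ - 2‖ := by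
    rw [← dist_eq_norm]
    exact Metric.infDist_le_dist_of_mem ⟨2, by norm_num, by norm_num⟩
  have h3 : distCut (z + z⁻¹) ≤ ‖z + z⁻¹ + 2‖ := by
    rw [show z + z⁻¹ + 2 = z + z⁻¹ - (-2) by ring, ← dist_eq_norm]
    exact Metric.infDist_le_dist_of_mem ⟨-2, by norm_num, by norm_num⟩
  refine le_of_sq_le_sq ?_ (norm_nonneg _)
  rw [← norm_joukowski_sq_sub_four hz,
    show (z + z⁻¹) ^ 2 - 4 = (z + z⁻¹ - 2) * (z + z⁻¹ + 2) by ring, norm_mul, sq]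
  exact mul_le_mul h2 h3 Metric.infDist_nonneg (norm_nonneg _)

theorem distCut_joukowski_le_mul {z : ℂ} (hz : z ≠ 0) (hz1 : ‖z‖ < 1) :
    distCut (z + z⁻¹) ≤ 2 * (1 - ‖z‖) * ‖z⁻¹ - z‖ := by
  have hq : 0 < ‖z‖ := norm_pos_iff.2 hz
  have hq' : (‖z‖ : ℂ) ≠ 0 := by exact_mod_cast hq.ne'
  -- The comparison point on the segment comes from the radial projection of `z` to the unit circle.
  set u : ℂ := z / ‖z‖ with hu
  have hu1 : ‖u‖ = 1 := by rw [hu, norm_div, Complex.norm_real, norm_norm, div_self hq.ne']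
  have hu0 : u ≠ 0 := by rw [hu]; positivity
  have hzu : z = ‖z‖ * u := by rw [hu]; field_simp
  have h1 : distCut (z + z⁻¹) ≤ ‖z + z⁻¹ - (u + u⁻¹)‖ := by
    rw [← dist_eq_norm]
    exact Metric.infDist_le_dist_of_mem (unit_add_inv_mem_cutSegment hu1)
  refine h1.trans ?_
  rw [joukowski_sub hz hu0, inv_sub_self_eq hz, norm_div, norm_div, norm_mul, mul_div_assoc']
  refine div_le_div_of_nonneg_right ?_ hq.le
  have h2 : ‖z - u‖ = 1 - ‖z‖ := by
    have : z - u = ((‖z‖ - 1 : ℝ) : ℂ) * u := by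
      push_cast; rw [sub_mul, one_mul, ← hzu]
    rw [this, norm_mul, hu1, mul_one, Complex.norm_real, Real.norm_eq_abs, abs_sub_comm,
      abs_of_pos (by linarith)]
  have h3 : ‖z - u⁻¹‖ ≤ 2 * ‖1 - z ^ 2‖ := by
    have e : (z - u⁻¹) * u = -(1 - z ^ 2) + ((‖z‖ * (1 - ‖z‖) : ℝ) : ℂ) * u ^ 2 := by
      have : (z - u⁻¹) * u = z * u - 1 := by field_simp
      rw [this]
      push_cast
      linear_combination (u + z + ‖z‖ * u - u) * (-hzu) + u * hzu
    have : ‖z - u⁻¹‖ = ‖(z - u⁻¹) * u‖ := by rw [norm_mul, hu1, mul_one]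
    rw [this, e]
    refine (norm_add_le _ _).trans ?_
    rw [norm_neg, norm_mul, norm_pow, hu1, one_pow, mul_one, Complex.norm_real, Real.norm_eq_abs,
      abs_of_nonneg (mul_nonneg hq.le (by linarith))]
    nlinarith [one_sub_sq_le_norm z]
  rw [h2]
  nlinarith [mul_le_mul_of_nonneg_left h3 (by linarith : (0:ℝ) ≤ 1 - ‖z‖)]

theorem exists_root_norm_le_one (w : ℂ) : ∃ z : ℂ, z ≠ 0 ∧ ‖z‖ ≤ 1 ∧ z + z⁻¹ = w := by
  obtain ⟨d, hd⟩ := IsAlgClosed.exists_pow_nat_eq (w ^ 2 - 4) (n := 2) (by norm_num)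
  have hmul : (w - d) / 2 * ((w + d) / 2) = 1 := by linear_combination (-1/4) * hd
  have h0 : (w - d) / 2 ≠ 0 := left_ne_zero_of_mul_eq_one hmul
  have hinv : ((w - d) / 2)⁻¹ = (w + d) / 2 := inv_eq_of_mul_eq_one_right hmul
  rcases le_total ‖(w - d) / 2‖ 1 with h | h
  · exact ⟨_, h0, h, by rw [hinv]; ring⟩
  · refine ⟨(w + d) / 2, right_ne_zero_of_mul_eq_one hmul, ?_, ?_⟩
    · rw [← hinv, norm_inv]; exact inv_le_one_of_one_le₀ h
    · rw [← hinv, inv_inv, hinv]; ring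

theorem exists_joukowski_eq {w : ℂ} (hw : w ∉ cutSegment) :
    ∃ z : ℂ, z ≠ 0 ∧ ‖z‖ < 1 ∧ z + z⁻¹ = w := by
  obtain ⟨z, h0, h1, h2⟩ := exists_root_norm_le_one w
  refine ⟨z, h0, lt_of_le_of_ne h1 fun h => hw ?_, h2⟩
  rw [← h2]; exact unit_add_inv_mem_cutSegment h

theorem exists_inv_sub_self_eq (w : ℂ) : ∃ z : ℂ, z ≠ 0 ∧ ‖z‖ ≤ 1 ∧ z⁻¹ - z = w := by
  obtain ⟨z, h0, h1, h2⟩ := exists_root_norm_le_one (Complex.I * w)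
  refine ⟨Complex.I * z, mul_ne_zero Complex.I_ne_zero h0, by simpa using h1, ?_⟩
  have h3 : z + z⁻¹ = Complex.I * w := h2
  rw [mul_inv, Complex.inv_I]
  linear_combination (-Complex.I) * h3 - w * Complex.I_mul_I

end Joukowski

/-! ### The odd Koebe function and its inverse -/

section Koebe

/-- The odd Koebe-type function `q / (1 - q²)` of the unit disc. -/
noncomputable def oddKoebe (q : ℂ) : ℂ := q / (1 - q ^ 2)

/-- The inverse of `oddKoebe`, on the set where `1 + 4w²` lies in the slit plane. -/
noncomputable def oddKoebeInv (w : ℂ) : ℂ := 2 * w / (1 + (1 + 4 * w ^ 2) ^ (2⁻¹ : ℂ))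

theorem one_sub_sq_ne_zero {q : ℂ} (hq : ‖q‖ < 1) : 1 - q ^ 2 ≠ 0 := by
  intro h
  have := one_sub_sq_le_norm q
  rw [h, norm_zero] at this
  nlinarith [norm_nonneg q]

theorem one_sub_ne_zero_of_norm_lt {q : ℂ} (hq : ‖q‖ < 1) : 1 - q ≠ 0 := by
  intro h
  rw [← sub_eq_zero.1 h, norm_one] at hq
  exact lt_irrefl _ hq

theorem re_cayley_pos {q : ℂ} (hq : ‖q‖ < 1) : 0 < ((1 + q) / (1 - q)).re := by
  have h1 : 0 < Complex.normSq (1 - q) := Complex.normSq_pos.2 (one_sub_ne_zero_of_norm_lt hq)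
  have h2 : q.re * q.re + q.im * q.im < 1 := by
    have := Complex.normSq_eq_norm_sq q
    rw [Complex.normSq_apply] at this
    rw [this]; nlinarith [norm_nonneg q]
  rw [Complex.div_re, ← add_div]
  refine div_pos ?_ h1
  simp only [Complex.add_re, Complex.add_im, Complex.sub_re, Complex.sub_im, Complex.one_re,
    Complex.one_im]
  nlinarith

theorem sq_mem_slitPlane {w : ℂ} (hw : 0 < w.re) : w ^ 2 ∈ Complex.slitPlane := by
  rw [Complex.mem_slitPlane_iff, sq, Complex.mul_re, Complex.mul_im]
  by_cases h : w.im = 0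
  · left; rw [h]; nlinarith
  · right
    rw [mul_comm w.im, ← two_mul]
    exact mul_ne_zero two_ne_zero (mul_ne_zero hw.ne' h)

theorem re_cpow_pos {w : ℂ} (hw : w ∈ Complex.slitPlane) {y : ℝ} (hy : |y| ≤ 1 / 2) :
    0 < (w ^ (y : ℂ)).re := by
  rw [Complex.cpow_ofReal_re]
  have h0 : 0 < ‖w‖ := norm_pos_iff.2 (Complex.slitPlane_ne_zero hw)
  refine mul_pos (Real.rpow_pos_of_pos h0 _) (Real.cos_pos_of_mem_Ioo ?_)
  have h1 : |w.arg| < Real.pi :=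
    lt_of_le_of_ne (Complex.abs_arg_le_pi w) fun h => by
      rcases abs_eq Real.pi_pos.le |>.1 h with h | h
      · exact (Complex.mem_slitPlane_iff_arg.1 hw).1 h
      · exact absurd h (Complex.neg_pi_lt_arg w).ne'
  rw [Set.mem_Ioo, ← abs_lt, abs_mul]
  nlinarith [abs_nonneg w.arg, abs_nonneg y]

theorem re_sqrt_pos {w : ℂ} (hw : w ∈ Complex.slitPlane) : 0 < (w ^ (2⁻¹ : ℂ)).re := by
  have := re_cpow_pos hw (y := 2⁻¹) (by rw [abs_of_pos] <;> norm_num)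
  simpa using this

theorem one_add_four_mul_oddKoebe_sq {q : ℂ} (hq : ‖q‖ < 1) :
    1 + 4 * oddKoebe q ^ 2 = ((1 + q ^ 2) / (1 - q ^ 2)) ^ 2 := by
  have := one_sub_sq_ne_zero hq
  unfold oddKoebe; field_simp; ring

theorem norm_sq_lt_one {q : ℂ} (hq : ‖q‖ < 1) : ‖q ^ 2‖ < 1 := by
  rw [norm_pow]; nlinarith [norm_nonneg q]

theorem one_add_four_mul_oddKoebe_sq_mem_slitPlane {q : ℂ} (hq : ‖q‖ < 1) :
    1 + 4 * oddKoebe q ^ 2 ∈ Complex.slitPlane := by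
  rw [one_add_four_mul_oddKoebe_sq hq]
  exact sq_mem_slitPlane (re_cayley_pos (norm_sq_lt_one hq))

theorem oddKoebeInv_oddKoebe {q : ℂ} (hq : ‖q‖ < 1) : oddKoebeInv (oddKoebe q) = q := by
  have h := one_sub_sq_ne_zero hq
  rw [oddKoebeInv, one_add_four_mul_oddKoebe_sq hq,
    Complex.sq_cpow_two_inv (re_cayley_pos (norm_sq_lt_one hq)), oddKoebe]
  have h2 : 1 + (1 + q ^ 2) / (1 - q ^ 2) = 2 / (1 - q ^ 2) := by field_simp; ring
  rw [h2]; field_simp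

theorem oddKoebeInv_zero : oddKoebeInv 0 = 0 := by simp [oddKoebeInv]

theorem one_add_sqrt_ne_zero {w : ℂ} (hw : w ∈ Complex.slitPlane) :
    1 + w ^ (2⁻¹ : ℂ) ≠ 0 := by
  intro h
  have := congrArg Complex.re h
  rw [Complex.add_re, Complex.one_re, Complex.zero_re] at this
  linarith [re_sqrt_pos hw]

/-- With `S` the root of `1 + 4w²` in the right half-plane, the square of the value is the Cayley
transform `(S - 1)/(S + 1)`. -/
theorem norm_oddKoebeInv_lt_one {w : ℂ} (hw : 1 + 4 * w ^ 2 ∈ Complex.slitPlane) :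
    ‖oddKoebeInv w‖ < 1 := by
  have hS := re_sqrt_pos hw
  have hne := one_add_sqrt_ne_zero hw
  have hsq := Complex.cpow_nat_inv_pow (1 + 4 * w ^ 2) (n := 2) two_ne_zero
  unfold oddKoebeInv
  rw [Nat.cast_ofNat] at hsq
  set S := (1 + 4 * w ^ 2) ^ (2⁻¹ : ℂ)
  have h1 : (2 * w) ^ 2 = (S - 1) * (S + 1) := by linear_combination -hsq
  have h2 : ‖S - 1‖ < ‖1 + S‖ := by
    refine lt_of_pow_lt_pow_left₀ 2 (norm_nonneg _) ?_
    rw [← Complex.normSq_eq_norm_sq, ← Complex.normSq_eq_norm_sq, Complex.normSq_apply,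
      Complex.normSq_apply]
    simp only [Complex.add_re, Complex.add_im, Complex.sub_re, Complex.sub_im, Complex.one_re,
      Complex.one_im]
    nlinarith
  have h3 : 0 < ‖1 + S‖ := norm_pos_iff.2 hne
  rw [norm_div, div_lt_one h3]
  refine lt_of_pow_lt_pow_left₀ 2 (norm_nonneg _) ?_
  rw [← norm_pow, h1, norm_mul, add_comm S, sq]
  exact mul_lt_mul_of_pos_right h2 h3

theorem oddKoebeInv_eq_mul {w : ℂ} (hw : 1 + 4 * w ^ 2 ∈ Complex.slitPlane) :
    oddKoebeInv w = w * (1 - oddKoebeInv w ^ 2) := by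
  have hne := one_add_sqrt_ne_zero hw
  have hsq := Complex.cpow_nat_inv_pow (1 + 4 * w ^ 2) (n := 2) two_ne_zero
  unfold oddKoebeInv
  rw [Nat.cast_ofNat] at hsq
  set S := (1 + 4 * w ^ 2) ^ (2⁻¹ : ℂ)
  field_simp
  linear_combination (-w) * hsq

theorem oddKoebe_oddKoebeInv {w : ℂ} (hw : 1 + 4 * w ^ 2 ∈ Complex.slitPlane) :
    oddKoebe (oddKoebeInv w) = w := by
  rw [oddKoebe, div_eq_iff (one_sub_sq_ne_zero (norm_oddKoebeInv_lt_one hw))]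
  exact oddKoebeInv_eq_mul hw

theorem differentiableAt_oddKoebe {q : ℂ} (hq : ‖q‖ < 1) : DifferentiableAt ℂ oddKoebe q := by
  unfold oddKoebe
  have := one_sub_sq_ne_zero hq
  fun_prop (disch := assumption)

theorem differentiableAt_oddKoebeInv {w : ℂ} (hw : 1 + 4 * w ^ 2 ∈ Complex.slitPlane) :
    DifferentiableAt ℂ oddKoebeInv w := by
  unfold oddKoebeInv
  have hne := one_add_sqrt_ne_zero hw
  refine DifferentiableAt.div (by fun_prop) ?_ hne
  refine DifferentiableAt.add (by fun_prop) ?_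
  exact DifferentiableAt.cpow_const (by fun_prop) hw

theorem inv_oddKoebe {q : ℂ} (hq0 : q ≠ 0) : (oddKoebe q)⁻¹ = q⁻¹ - q := by
  rw [oddKoebe, inv_div]
  field_simp

theorem oddKoebe_ne_zero {q : ℂ} (hq0 : q ≠ 0) (hq : ‖q‖ < 1) : oddKoebe q ≠ 0 :=
  div_ne_zero hq0 (one_sub_sq_ne_zero hq)

end Koebe

/-! ### The conformal map onto the region `|v| > s` -/

section DumbbellMap

variable {s : ℝ}

/-- The coordinate `p = s / v` of the exterior of the dumbbell. -/
noncomputable def dumbbellAux (s : ℝ) (ζ : ℂ) : ℂ :=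
  oddKoebeInv ((s / (1 + s ^ 2 / 4) : ℝ) * oddKoebe ζ)

/-- The conformal map of the unit disc onto the part of the disc on which the point
`v = z⁻¹ - z` has modulus larger than `s`. -/
noncomputable def dumbbellMap (s : ℝ) (ζ : ℂ) : ℂ := oddKoebeInv (dumbbellAux s ζ / s)

/-- The slit plane is star-shaped about `1`, and shrinking `w` by a real factor in `[0,1]` moves `1
+ 4w²` along the segment towards `1`. -/
theorem dumbbellAux_mem_slitPlane (hs : 0 < s) (hs1 : s ≤ 1) {ζ : ℂ} (hζ : ‖ζ‖ < 1) :
    1 + 4 * (((s / (1 + s ^ 2 / 4) : ℝ) : ℂ) * oddKoebe ζ) ^ 2 ∈ Complex.slitPlane := by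
  have h := Complex.starConvex_one_slitPlane.add_smul_mem
    (one_add_four_mul_oddKoebe_sq_mem_slitPlane hζ) (t := (s / (1 + s ^ 2 / 4)) ^ 2)
    (by positivity) (by
      have : s / (1 + s ^ 2 / 4) ≤ 1 := by
        rw [div_le_one (by positivity)]; nlinarith
      exact pow_le_one₀ (by positivity) this)
  convert h using 2
  rw [Complex.real_smul]; push_cast; ring

theorem norm_dumbbellAux_lt_one (hs : 0 < s) (hs1 : s ≤ 1) {ζ : ℂ} (hζ : ‖ζ‖ < 1) :
    ‖dumbbellAux s ζ‖ < 1 :=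
  norm_oddKoebeInv_lt_one (dumbbellAux_mem_slitPlane hs hs1 hζ)

theorem oddKoebe_dumbbellAux (hs : 0 < s) (hs1 : s ≤ 1) {ζ : ℂ} (hζ : ‖ζ‖ < 1) :
    oddKoebe (dumbbellAux s ζ) = ((s / (1 + s ^ 2 / 4) : ℝ) : ℂ) * oddKoebe ζ :=
  oddKoebe_oddKoebeInv (dumbbellAux_mem_slitPlane hs hs1 hζ)

/-- Otherwise `p² = -m` with `s²/4 ≤ m < 1`. Since `m/(1+m)²` increases on `[0,1]` and equals
`s²/(4(1 + s²/4)²)` at `m = s²/4`, this would put `1 + 4 * oddKoebe ζ ^ 2` on the slit. -/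
theorem dumbbellMap_mem_slitPlane (hs : 0 < s) (hs1 : s ≤ 1) {ζ : ℂ} (hζ : ‖ζ‖ < 1) :
    1 + 4 * (dumbbellAux s ζ / s) ^ 2 ∈ Complex.slitPlane := by
  by_contra hcon
  set p := dumbbellAux s ζ with hp
  have hp1 : ‖p‖ < 1 := norm_dumbbellAux_lt_one hs hs1 hζ
  have hK := oddKoebe_dumbbellAux hs hs1 hζ
  rw [← hp] at hK
  have hsC : (s : ℂ) ≠ 0 := by exact_mod_cast hs.ne'
  rw [Complex.mem_slitPlane_iff, not_or, not_lt, not_not] at hcon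
  obtain ⟨hre, him⟩ := hcon
  set x := (1 + 4 * (p / s) ^ 2).re with hx
  have hxx : 1 + 4 * (p / s) ^ 2 = (x : ℂ) := Complex.ext rfl (by simpa using him)
  set m : ℝ := s ^ 2 * (1 - x) / 4 with hm
  have hpm : p ^ 2 = -(m : ℂ) := by
    rw [hm]; push_cast; rw [← hxx]; field_simp; ring
  have hm0 : s ^ 2 / 4 ≤ m := by rw [hm]; nlinarith [sq_nonneg s]
  have hm1 : m < 1 := by
    have h1 : ‖p ^ 2‖ < 1 := norm_sq_lt_one hp1
    rw [hpm, norm_neg, Complex.norm_real, Real.norm_eq_abs] at h1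
    exact (abs_lt.1 h1).2
  have hmpos : 0 < m := lt_of_lt_of_le (by positivity) hm0
  have hslit := one_add_four_mul_oddKoebe_sq_mem_slitPlane hζ
  have hval : 1 + 4 * oddKoebe ζ ^ 2
      = ((1 - 4 * ((1 + s ^ 2 / 4) / s) ^ 2 * (m / (1 + m) ^ 2) : ℝ) : ℂ) := by
    have h2 : oddKoebe ζ = (((1 + s ^ 2 / 4) / s : ℝ) : ℂ) * oddKoebe p := by
      rw [hK, ← mul_assoc, ← Complex.ofReal_mul,
        show (1 + s ^ 2 / 4) / s * (s / (1 + s ^ 2 / 4)) = 1 by field_simp]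
      simp
    have h3 : oddKoebe p ^ 2 = ((-(m / (1 + m) ^ 2) : ℝ) : ℂ) := by
      rw [oddKoebe, div_pow, hpm]; push_cast; ring
    rw [h2, mul_pow, h3]; push_cast; ring
  rw [hval, Complex.mem_slitPlane_iff, Complex.ofReal_re, Complex.ofReal_im] at hslit
  have hneg : 1 - 4 * ((1 + s ^ 2 / 4) / s) ^ 2 * (m / (1 + m) ^ 2) ≤ 0 := by
    have e : 4 * ((1 + s ^ 2 / 4) / s) ^ 2 * (m / (1 + m) ^ 2)
        = 4 * (1 + s ^ 2 / 4) ^ 2 * m / (s ^ 2 * (1 + m) ^ 2) := by field_simp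
    rw [sub_nonpos, e, one_le_div (by positivity)]
    have : (m - s ^ 2 / 4) * (s ^ 2 * m - 4) ≤ 0 :=
      mul_nonpos_of_nonneg_of_nonpos (by linarith) (by nlinarith)
    nlinarith
  rcases hslit with h | h
  · linarith
  · exact h rfl

theorem norm_dumbbellMap_lt_one (hs : 0 < s) (hs1 : s ≤ 1) {ζ : ℂ} (hζ : ‖ζ‖ < 1) :
    ‖dumbbellMap s ζ‖ < 1 :=
  norm_oddKoebeInv_lt_one (dumbbellMap_mem_slitPlane hs hs1 hζ)

theorem oddKoebe_dumbbellMap (hs : 0 < s) (hs1 : s ≤ 1) {ζ : ℂ} (hζ : ‖ζ‖ < 1) :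
    oddKoebe (dumbbellMap s ζ) = dumbbellAux s ζ / s :=
  oddKoebe_oddKoebeInv (dumbbellMap_mem_slitPlane hs hs1 hζ)

theorem dumbbellMap_zero (s : ℝ) : dumbbellMap s 0 = 0 := by
  simp [dumbbellMap, dumbbellAux, oddKoebe, oddKoebeInv_zero]

theorem differentiableOn_dumbbellMap (hs : 0 < s) (hs1 : s ≤ 1) :
    DifferentiableOn ℂ (dumbbellMap s) (Metric.ball 0 1) := by
  intro ζ hζ
  rw [mem_ball_zero_iff] at hζ
  refine DifferentiableAt.differentiableWithinAt ?_
  have h1 : DifferentiableAt ℂ (dumbbellAux s) ζ :=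
    DifferentiableAt.comp ζ (differentiableAt_oddKoebeInv (dumbbellAux_mem_slitPlane hs hs1 hζ))
      ((differentiableAt_oddKoebe hζ).const_mul _)
  exact DifferentiableAt.comp ζ
    (differentiableAt_oddKoebeInv (dumbbellMap_mem_slitPlane hs hs1 hζ)) (h1.div_const _)

theorem norm_dumbbellMap_le (hs : 0 < s) (hs1 : s ≤ 1) {ζ : ℂ} (hζ : ‖ζ‖ < 1) :
    ‖dumbbellMap s ζ‖ ≤ ‖ζ‖ :=
  Complex.norm_le_norm_of_mapsTo_ball (differentiableOn_dumbbellMap hs hs1)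
    (fun w hw => by
      rw [mem_closedBall_zero_iff]
      exact (norm_dumbbellMap_lt_one hs hs1 (mem_ball_zero_iff.1 hw)).le)
    (dumbbellMap_zero s) hζ

theorem dumbbellMap_ne_zero (hs : 0 < s) (hs1 : s ≤ 1) {ζ : ℂ} (hζ0 : ζ ≠ 0) (hζ : ‖ζ‖ < 1) :
    dumbbellMap s ζ ≠ 0 := by
  intro h
  have h1 := oddKoebe_dumbbellMap hs hs1 hζ
  have h2 := oddKoebe_dumbbellAux hs hs1 hζ
  have hsC : (s : ℂ) ≠ 0 := by exact_mod_cast hs.ne'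
  rw [h, show oddKoebe 0 = 0 by simp [oddKoebe], eq_comm, div_eq_zero_iff, or_iff_left hsC] at h1
  rw [h1, show oddKoebe 0 = 0 by simp [oddKoebe], eq_comm, mul_eq_zero] at h2
  rcases h2 with h2 | h2
  · have : s / (1 + s ^ 2 / 4) ≠ 0 := by positivity
    exact this (by exact_mod_cast h2)
  · exact oddKoebe_ne_zero hζ0 hζ h2

/-- In the `v`-plane the disc becomes the exterior of `[-2i, 2i]`. The map `v ↦ v - s²/v` flattens
the circle `|v| = s` into the imaginary axis and sends `±2i` to `±2i(1 + s²/4)`, whence the factor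
on the right. -/
theorem dumbbellMap_relation (hs : 0 < s) (hs1 : s ≤ 1) {ζ : ℂ} (hζ0 : ζ ≠ 0) (hζ : ‖ζ‖ < 1) :
    s < ‖(dumbbellMap s ζ)⁻¹ - dumbbellMap s ζ‖ ∧
    ((dumbbellMap s ζ)⁻¹ - dumbbellMap s ζ) - s ^ 2 / ((dumbbellMap s ζ)⁻¹ - dumbbellMap s ζ)
      = (1 + s ^ 2 / 4 : ℝ) * (ζ⁻¹ - ζ) := by
  have hZ := dumbbellMap_ne_zero hs hs1 hζ0 hζ
  have hsC : (s : ℂ) ≠ 0 := by exact_mod_cast hs.ne'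
  have h1 := oddKoebe_dumbbellMap hs hs1 hζ
  have h2 := oddKoebe_dumbbellAux hs hs1 hζ
  have hp1 := norm_dumbbellAux_lt_one hs hs1 hζ
  rw [← inv_oddKoebe hZ, h1]
  have hp0 : dumbbellAux s ζ ≠ 0 := by
    intro h
    rw [h, zero_div] at h1
    exact oddKoebe_ne_zero hZ (norm_dumbbellMap_lt_one hs hs1 hζ) h1
  constructor
  · rw [inv_div, norm_div, Complex.norm_real, Real.norm_of_nonneg hs.le,
      lt_div_iff₀ (norm_pos_iff.2 hp0)]
    nlinarith
  · have h3 := congrArg (·⁻¹) h2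
    simp only [mul_inv] at h3
    rw [inv_oddKoebe hp0, inv_oddKoebe hζ0, ← Complex.ofReal_inv, inv_div,
      Complex.ofReal_div] at h3
    have e : (dumbbellAux s ζ / s)⁻¹ - s ^ 2 / (dumbbellAux s ζ / s)⁻¹
        = s * ((dumbbellAux s ζ)⁻¹ - dumbbellAux s ζ) := by
      field_simp
    rw [e, h3]; field_simp

end DumbbellMap

/-! ### Distortion of the dumbbell map and a harmonic majorant -/

section Estimates

/-- Elliptic coordinates of `z⁻¹ - z`. -/
theorem exists_elliptic_coords {z : ℂ} (hz : z ≠ 0) :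
    ∃ σ : ℝ, 0 ≤ σ ∧ σ ≤ 1 ∧
      (z⁻¹ - z).re ^ 2 = 4 * ((‖z‖⁻¹ - ‖z‖) / 2) ^ 2 * (1 - σ) ∧
      (z⁻¹ - z).im ^ 2 = 4 * (((‖z‖⁻¹ - ‖z‖) / 2) ^ 2 + 1) * σ := by
  have hq : 0 < ‖z‖ := norm_pos_iff.2 hz
  have hn : ‖z‖ ^ 2 = z.re ^ 2 + z.im ^ 2 := by
    rw [← Complex.normSq_eq_norm_sq, Complex.normSq_apply]; ring
  have hre : (z⁻¹ - z).re = z.re / ‖z‖ ^ 2 - z.re := by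
    rw [Complex.sub_re, Complex.inv_re, Complex.normSq_eq_norm_sq]
  have him : (z⁻¹ - z).im = -z.im / ‖z‖ ^ 2 - z.im := by
    rw [Complex.sub_im, Complex.inv_im, Complex.normSq_eq_norm_sq]
  have hre2 : z.re ^ 2 = ‖z‖ ^ 2 - z.im ^ 2 := by linarith
  refine ⟨z.im ^ 2 / ‖z‖ ^ 2, by positivity, ?_, ?_, ?_⟩
  · rw [div_le_one (by positivity), hn]; nlinarith [sq_nonneg z.re]
  · rw [hre]
    have : (z.re / ‖z‖ ^ 2 - z.re) ^ 2 = z.re ^ 2 * (1 / ‖z‖ ^ 2 - 1) ^ 2 := by ring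
    rw [this, hre2]; field_simp; ring
  · rw [him]; field_simp; ring

/-- Here `N` and `M` stand for `sinh²` of `-log |z|` and `-log |ζ|`, and `t` for `s²/|v|²`. If `M <
N/4`, eliminating `κ` from the two equations gives an inequality that is already false at `t = 0`
and stays false for small `t`. -/
theorem sinh_sq_le_of_elliptic {N M σ κ t A : ℝ} (hN : 0 < N) (hN1 : N ≤ 1)
    (hσ : 0 ≤ σ) (hσ1 : σ ≤ 1) (hκ : 0 ≤ κ) (hκ1 : κ ≤ 1) (ht : 0 ≤ t) (ht1 : t ≤ 1 / 64)
    (hA : A = 1 + t * (N + σ))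
    (h1 : A ^ 2 * M * (1 - κ) = N * (1 - σ) * (1 - t) ^ 2)
    (h2 : A ^ 2 * (M + 1) * κ = (N + 1) * σ * (1 + t) ^ 2) : N / 4 ≤ M := by
  by_contra! hlt
  have hX : 0 ≤ A ^ 2 * κ := by positivity
  have hY : 0 ≤ A ^ 2 * (1 - κ) := mul_nonneg (sq_nonneg _) (by linarith)
  have e1 : 4 * (1 - σ) * (1 - t) ^ 2 ≤ A ^ 2 * (1 - κ) := by
    have : N * (4 * (1 - σ) * (1 - t) ^ 2) ≤ N * (A ^ 2 * (1 - κ)) := by nlinarith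
    exact le_of_mul_le_mul_left this hN
  have e2 : (N + 1) * σ * (1 + t) ^ 2 ≤ (N / 4 + 1) * (A ^ 2 * κ) := by nlinarith
  have e3 : (N + 1) * σ * (1 + t) ^ 2
      ≤ (N / 4 + 1) * (A ^ 2 - 4 * (1 - σ) * (1 - t) ^ 2) := by
    refine e2.trans (mul_le_mul_of_nonneg_left (by linarith) (by linarith))
  obtain ⟨δ, rfl⟩ : ∃ δ, σ = 1 - δ := ⟨1 - σ, by ring⟩
  have hδ : 0 ≤ δ := by linarith
  have hδ1 : δ ≤ 1 := by linarith
  -- At `t = 0` the difference is `3N/4 + 3δ > 0`; for `t ≤ 1/64` the other terms subtract at most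
  -- `(5N + 14δ)/64`.
  have key : (N + 1) * (1 - δ) * (1 + t) ^ 2
      - (N / 4 + 1) * (A ^ 2 - 4 * (1 - (1 - δ)) * (1 - t) ^ 2)
      = 3 * N / 4 + 3 * δ + t * (-(N / 2) * (N + 1) - δ * (7 * N / 2 + 8))
        + t ^ 2 * ((N + 1) * (1 - δ) - (N / 4 + 1) * ((N + 1 - δ) ^ 2 - 4 * δ)) := by
    rw [hA]; ring
  have d1 : -(N + 12 * δ) ≤ -(N / 2) * (N + 1) - δ * (7 * N / 2 + 8) := by
    have f3 : N * N ≤ N := mul_le_of_le_one_left hN.le hN1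
    have f4 : N * δ ≤ δ := mul_le_of_le_one_left hδ hN1
    linarith
  have d2 : -(4 * N + 2 * δ) ≤ (N + 1) * (1 - δ) - (N / 4 + 1) * ((N + 1 - δ) ^ 2 - 4 * δ) := by
    have f1 : (N + 1 - δ) ^ 2 ≤ 1 + 3 * N := by nlinarith
    have f2 : (N / 4 + 1) * ((N + 1 - δ) ^ 2 - 4 * δ) ≤ (N / 4 + 1) * (1 + 3 * N) := by
      refine mul_le_mul_of_nonneg_left (by linarith) (by linarith)
    have f3 : N * N ≤ N := mul_le_of_le_one_left hN.le hN1
    have f4 : N * δ ≤ δ := mul_le_of_le_one_left hδ hN1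
    linarith
  have t2 : t ^ 2 ≤ t := by nlinarith
  have g1 : t * -(N + 12 * δ) ≤ t * (-(N / 2) * (N + 1) - δ * (7 * N / 2 + 8)) :=
    mul_le_mul_of_nonneg_left d1 ht
  have g2 : t ^ 2 * -(4 * N + 2 * δ)
      ≤ t ^ 2 * ((N + 1) * (1 - δ) - (N / 4 + 1) * ((N + 1 - δ) ^ 2 - 4 * δ)) :=
    mul_le_mul_of_nonneg_left d2 (sq_nonneg t)
  have g3 : t ^ 2 * (4 * N + 2 * δ) ≤ 1 / 64 * (4 * N + 2 * δ) :=
    mul_le_mul_of_nonneg_right (t2.trans ht1) (by positivity)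
  have g4 : t * (N + 12 * δ) ≤ 1 / 64 * (N + 12 * δ) :=
    mul_le_mul_of_nonneg_right ht1 (by positivity)
  linarith

theorem exists_dumbbellMap_eq {s : ℝ} (hs : 0 < s) (hs1 : s ≤ 1) {z : ℂ}
    (hz : ‖z‖ < 1) (hz2 : 1 / 2 ≤ ‖z‖) (hsz : 8 * s ≤ ‖z⁻¹ - z‖) :
    ∃ ζ : ℂ, ζ ≠ 0 ∧ ‖ζ‖ < 1 ∧ dumbbellMap s ζ = z ∧ (1 - ‖z‖) / 4 ≤ 1 - ‖ζ‖ := by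
  have hq : 0 < ‖z‖ := by linarith
  have hz0 : z ≠ 0 := norm_pos_iff.1 hq
  have hsC : (s : ℂ) ≠ 0 := by exact_mod_cast hs.ne'
  set a : ℝ := 1 + s ^ 2 / 4 with ha
  have ha0 : 0 < a := by positivity
  have haC : (a : ℂ) ≠ 0 := by exact_mod_cast ha0.ne'
  set v := z⁻¹ - z with hv
  have hv0 : 0 < ‖v‖ := by linarith
  have hvC : v ≠ 0 := norm_pos_iff.1 hv0
  -- The preimage solves the defining relation of the map; that it lies strictly inside the disc
  -- follows only from the comparison of `M` with `N`.
  obtain ⟨ζ, hζ0, hζ1, hζ⟩ := exists_inv_sub_self_eq ((v - s ^ 2 / v) / a)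
  obtain ⟨σ, hσ, hσ1, hvre, hvim⟩ := exists_elliptic_coords hz0
  obtain ⟨κ, hκ, hκ1, hUre, hUim⟩ := exists_elliptic_coords hζ0
  rw [← hv] at hvre hvim
  set N := ((‖z‖⁻¹ - ‖z‖) / 2) ^ 2 with hN
  set M := ((‖ζ‖⁻¹ - ‖ζ‖) / 2) ^ 2 with hM
  set t := s ^ 2 / ‖v‖ ^ 2 with ht
  have hnv : ‖v‖ ^ 2 = v.re ^ 2 + v.im ^ 2 := by
    rw [← Complex.normSq_eq_norm_sq, Complex.normSq_apply]; ring
  have ht1 : t ≤ 1 / 64 := by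
    rw [ht, div_le_div_iff₀ (by positivity) (by norm_num)]; nlinarith
  have hA : a = 1 + t * (N + σ) := by
    have : t * ‖v‖ ^ 2 = s ^ 2 := by rw [ht]; field_simp
    rw [hnv, hvre, hvim] at this
    rw [ha, ← this]; ring
  have hUv : (a : ℂ) * (ζ⁻¹ - ζ) = v - s ^ 2 / v := by rw [hζ]; field_simp
  have hinv : (s ^ 2 : ℂ) / v = (t : ℂ) * (starRingEnd ℂ) v := by
    rw [div_eq_iff hvC, mul_assoc, mul_comm _ v, Complex.mul_conj, Complex.normSq_eq_norm_sq, ht]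
    rw [← Complex.ofReal_mul, div_mul_cancel₀ _ (by positivity)]; push_cast; rfl
  have hre : a * (ζ⁻¹ - ζ).re = v.re * (1 - t) := by
    have := congrArg Complex.re hUv
    rw [Complex.re_ofReal_mul, hinv, Complex.sub_re v, Complex.re_ofReal_mul, Complex.conj_re] at this
    rw [this]; ring
  have him : a * (ζ⁻¹ - ζ).im = v.im * (1 + t) := by
    have := congrArg Complex.im hUv
    rw [Complex.im_ofReal_mul, hinv, Complex.sub_im v, Complex.im_ofReal_mul, Complex.conj_im] at this
    rw [this]; ring
  have h1 : a ^ 2 * M * (1 - κ) = N * (1 - σ) * (1 - t) ^ 2 := by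
    have := congrArg (· ^ 2) hre
    simp only [mul_pow] at this
    rw [hUre, hvre] at this; linarith
  have h2 : a ^ 2 * (M + 1) * κ = (N + 1) * σ * (1 + t) ^ 2 := by
    have := congrArg (· ^ 2) him
    simp only [mul_pow] at this
    rw [hUim, hvim] at this; linarith
  have hqi : 1 < ‖z‖⁻¹ := (one_lt_inv₀ hq).2 hz
  have hqi2 : ‖z‖⁻¹ ≤ 2 := by
    rw [inv_le_comm₀ hq (by norm_num)]; linarith
  have hNpos : 0 < N := by
    have : 0 < (‖z‖⁻¹ - ‖z‖) / 2 := by linarith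
    positivity
  have hN1 : N ≤ 1 := by
    rw [hN]; exact pow_le_one₀ (by linarith) (by linarith)
  have hMN : N / 4 ≤ M := sinh_sq_le_of_elliptic hNpos hN1 hσ hσ1 hκ hκ1
    (by positivity) ht1 hA h1 h2
  have hp0 : 0 < ‖ζ‖ := norm_pos_iff.2 hζ0
  have hroot : (‖z‖⁻¹ - ‖z‖) / 2 ≤ ‖ζ‖⁻¹ - ‖ζ‖ := by
    have h0 : 0 ≤ ‖ζ‖⁻¹ - ‖ζ‖ := by
      have := (one_le_inv₀ hp0).2 hζ1
      linarith
    refine le_of_sq_le_sq ?_ h0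
    rw [hN, hM] at hMN
    nlinarith
  have hζlt : ‖ζ‖ < 1 := by
    refine lt_of_le_of_ne hζ1 fun h => ?_
    rw [h] at hroot; norm_num at hroot; linarith
  have hmap : dumbbellMap s ζ = z := by
    have hp : ‖(s : ℂ) / v‖ < 1 := by
      rw [norm_div, Complex.norm_real, Real.norm_of_nonneg hs.le, div_lt_one hv0]; linarith
    have hK : ((s / a : ℝ) : ℂ) * oddKoebe ζ = oddKoebe (s / v) := by
      have e : (oddKoebe ((s : ℂ) / v))⁻¹ = (((s / a : ℝ) : ℂ) * oddKoebe ζ)⁻¹ := by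
        rw [inv_oddKoebe (div_ne_zero hsC hvC), mul_inv, inv_oddKoebe hζ0, hζ]
        push_cast; field_simp
      exact (inv_injective e).symm
    have hvz : (s : ℂ) / v / s = oddKoebe z := by
      have : (oddKoebe z)⁻¹ = v := inv_oddKoebe hz0
      rw [← inv_inv (oddKoebe z), this]; field_simp
    rw [dumbbellMap, dumbbellAux, hK, oddKoebeInv_oddKoebe hp, hvz, oddKoebeInv_oddKoebe hz]
  refine ⟨ζ, hζ0, hζlt, hmap, ?_⟩
  have hle : ‖z‖ ≤ ‖ζ‖ := by rw [← hmap]; exact norm_dumbbellMap_le hs hs1 hζlt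
  have hz' : ‖z‖⁻¹ * ‖z‖ = 1 := inv_mul_cancel₀ hq.ne'
  have hζ' : ‖ζ‖⁻¹ * ‖ζ‖ = 1 := inv_mul_cancel₀ hp0.ne'
  have e1 : (‖z‖⁻¹ - ‖z‖) * ‖z‖ ≤ 2 * ((‖ζ‖⁻¹ - ‖ζ‖) * ‖ζ‖) := by
    have h0 : 0 ≤ 2 * (‖ζ‖⁻¹ - ‖ζ‖) := by linarith
    have := mul_le_mul (by linarith : ‖z‖⁻¹ - ‖z‖ ≤ 2 * (‖ζ‖⁻¹ - ‖ζ‖)) hle hq.le h0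
    linarith
  have e2 : 1 - ‖z‖ ^ 2 ≤ 2 * (1 - ‖ζ‖ ^ 2) := by
    rw [sub_mul, sub_mul, hz', hζ'] at e1; linarith
  have e3 : ‖z‖ ^ 2 ≤ ‖z‖ := by rw [sq]; exact mul_le_of_le_one_left hq.le hz.le
  have e4 : 1 - ‖ζ‖ ^ 2 ≤ 2 * (1 - ‖ζ‖) := by linarith [sq_nonneg (1 - ‖ζ‖)]
  linarith

/-- Since `|v| > s`, the term `s²/v` is no larger than `v`, so `|ζ⁻¹ - ζ| ≤ 2|v|`. -/
theorem dumbbellMap_norm_bounds {s : ℝ} (hs : 0 < s) (hs1 : s ≤ 1) {ζ : ℂ} (hζ0 : ζ ≠ 0)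
    (hζ : ‖ζ‖ < 1) :
    s ≤ ‖(dumbbellMap s ζ)⁻¹ - dumbbellMap s ζ‖ ∧
    ‖1 - ζ ^ 2‖ / 2 ≤ ‖(dumbbellMap s ζ)⁻¹ - dumbbellMap s ζ‖ := by
  obtain ⟨h1, h2⟩ := dumbbellMap_relation hs hs1 hζ0 hζ
  refine ⟨h1.le, ?_⟩
  set v := (dumbbellMap s ζ)⁻¹ - dumbbellMap s ζ
  have hv : 0 < ‖v‖ := hs.trans h1
  have h3 : ‖v - s ^ 2 / v‖ ≤ ‖v‖ + ‖v‖ := by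
    refine (norm_sub_le _ _).trans (by gcongr ?_ + ?_; · exact le_rfl
                                       rw [norm_div, norm_pow, Complex.norm_real,
                                         Real.norm_of_nonneg hs.le, div_le_iff₀ hv]
                                       nlinarith)
  rw [h2, inv_sub_self_eq hζ0, norm_mul, norm_div, Complex.norm_real,
    Real.norm_of_nonneg (by positivity)] at h3
  have h4 : ‖1 - ζ ^ 2‖ ≤ ‖1 - ζ ^ 2‖ / ‖ζ‖ :=
    le_div_self (norm_nonneg _) (norm_pos_iff.2 hζ0) hζ.le
  have h5 : ‖1 - ζ ^ 2‖ / ‖ζ‖ ≤ (1 + s ^ 2 / 4) * (‖1 - ζ ^ 2‖ / ‖ζ‖) :=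
    le_mul_of_one_le_left (by positivity) (by nlinarith)
  linarith

theorem inv_majorant_le {α β ε : ℝ} (hα : 0 ≤ α) (hε : 0 < ε) {z : ℂ}
    (hz : z ≠ 0) (hz1 : ‖z‖ ≤ 1 - ε) :
    (distCut (z + z⁻¹) ^ α * ‖(z + z⁻¹) ^ 2 - 4‖ ^ β)⁻¹
      ≤ (2 / ε) ^ α * ‖z⁻¹ - z‖ ^ (-(α + 2 * β)) := by
  have hv := norm_inv_sub_self_pos hz (by linarith)
  set r := ‖z⁻¹ - z‖ with hr
  have h1 : ε / 2 * r ≤ distCut (z + z⁻¹) := by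
    refine le_trans ?_ (le_distCut_joukowski hz)
    rw [← hr]; nlinarith
  have h2 : (ε / 2 * r) ^ α * (r ^ 2) ^ β ≤ distCut (z + z⁻¹) ^ α * ‖(z + z⁻¹) ^ 2 - 4‖ ^ β := by
    rw [norm_joukowski_sq_sub_four hz, ← hr]
    gcongr
  refine (inv_anti₀ (by positivity) h2).trans (le_of_eq ?_)
  rw [Real.mul_rpow (by positivity) hv.le, ← Real.rpow_natCast r 2, ← Real.rpow_mul hv.le,
    Real.rpow_neg hv.le, Real.rpow_add hv, mul_inv, mul_inv, mul_inv, ← Real.inv_rpow (by positivity),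
    inv_div]
  push_cast; ring

/-- As `|arg w| ≤ π/2`, the cosine of `ρ * arg w` stays away from `0`. This trades a power of a
modulus for a harmonic function, whose circle averages are explicit. -/
theorem norm_rpow_neg_le_re_cpow {ρ : ℝ} (h0 : 0 ≤ ρ) (h1 : ρ < 1) {w : ℂ} (hw : 0 < w.re) :
    ‖w‖ ^ (-ρ) * Real.cos (ρ * (Real.pi / 2)) ≤ (w ^ ((-ρ : ℝ) : ℂ)).re := by
  rw [Complex.cpow_ofReal_re]
  refine mul_le_mul_of_nonneg_left ?_ (by positivity)
  have h2 : |w.arg| ≤ Real.pi / 2 := Complex.abs_arg_le_pi_div_two_iff.2 hw.le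
  rw [← Real.cos_abs (w.arg * -ρ), abs_mul, abs_neg, abs_of_nonneg h0]
  refine Real.cos_le_cos_of_nonneg_of_le_pi (by positivity) ?_ ?_
  · nlinarith [Real.pi_pos]
  · rw [mul_comm]; gcongr

theorem re_one_sub_sq_pos {ζ : ℂ} (hζ : ‖ζ‖ < 1) : 0 < (1 - ζ ^ 2).re := by
  rw [Complex.sub_re, Complex.one_re]
  have := (Complex.re_le_norm (ζ ^ 2)).trans_lt (norm_sq_lt_one hζ)
  linarith

theorem circleAverage_re_one_sub_sq_cpow {R : ℝ} (hR0 : 0 < R) (hR : R < 1) (y : ℝ) :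
    CircleIntegrable (fun ζ : ℂ => ((1 - ζ ^ 2) ^ (y : ℂ)).re) 0 R ∧
    Real.circleAverage (fun ζ : ℂ => ((1 - ζ ^ 2) ^ (y : ℂ)).re) 0 R = 1 := by
  have hd : DifferentiableOn ℂ (fun ζ : ℂ => (1 - ζ ^ 2) ^ (y : ℂ)) (Metric.ball 0 1) := by
    intro ζ hζ
    refine DifferentiableAt.differentiableWithinAt ?_
    refine DifferentiableAt.cpow_const (by fun_prop) ?_
    rw [Complex.mem_slitPlane_iff]; left
    exact re_one_sub_sq_pos (mem_ball_zero_iff.1 hζ)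
  have hsub : Metric.closedBall (0 : ℂ) R ⊆ Metric.ball 0 1 :=
    Metric.closedBall_subset_ball hR
  have hc : ContinuousOn (fun ζ : ℂ => (1 - ζ ^ 2) ^ (y : ℂ)) (Metric.sphere 0 R) :=
    hd.continuousOn.mono (Metric.sphere_subset_closedBall.trans hsub)
  have hi : CircleIntegrable (fun ζ : ℂ => (1 - ζ ^ 2) ^ (y : ℂ)) 0 R :=
    hc.circleIntegrable hR0.le
  refine ⟨(Complex.continuous_re.comp_continuousOn hc).circleIntegrable hR0.le, ?_⟩
  have h1 := Complex.reCLM.circleAverage_comp_comm hi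
  have h2 : Real.circleAverage (fun ζ : ℂ => (1 - ζ ^ 2) ^ (y : ℂ)) 0 R = 1 := by
    rw [DiffContOnCl.circleAverage]
    · simp
    · rw [abs_of_pos hR0]
      exact (hd.mono (by
        rw [closure_ball _ hR0.ne']; exact hsub)).diffContOnCl
  rw [h2] at h1
  exact h1.trans Complex.one_re

end Estimates

/-! ### Pulling `g` back to the disc -/

section Pullback

/-- The pullback of `g` to the unit disc by `z ↦ z + z⁻¹`, with the value `1` at the origin. -/
noncomputable def diskPullback (g : ℂ → ℂ) (z : ℂ) : ℂ := if z = 0 then 1 else g (z + z⁻¹)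

/-- A holomorphic self-map of the unit disc that vanishes at the origin and only there. -/
structure IsDiskMap (Z : ℂ → ℂ) : Prop where
  differentiableOn : DifferentiableOn ℂ Z (Metric.ball 0 1)
  norm_lt_one : ∀ ζ, ‖ζ‖ < 1 → ‖Z ζ‖ < 1
  map_zero : Z 0 = 0
  ne_zero : ∀ ζ, ζ ≠ 0 → ‖ζ‖ < 1 → Z ζ ≠ 0

theorem isDiskMap_id : IsDiskMap (fun ζ => ζ) :=
  ⟨differentiableOn_id, fun _ h => h, rfl, fun _ h _ => h⟩

theorem isDiskMap_dumbbellMap {s : ℝ} (hs : 0 < s) (hs1 : s ≤ 1) : IsDiskMap (dumbbellMap s) :=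
  ⟨differentiableOn_dumbbellMap hs hs1, fun _ => norm_dumbbellMap_lt_one hs hs1,
    dumbbellMap_zero s, fun _ => dumbbellMap_ne_zero hs hs1⟩

theorem tendsto_joukowski_cobounded :
    Filter.Tendsto (fun z : ℂ => z + z⁻¹) (𝓝[≠] 0) (Bornology.cobounded ℂ) := by
  rw [← tendsto_norm_atTop_iff_cobounded]
  have h1 : Filter.Tendsto (fun z : ℂ => ‖z⁻¹‖ - 1) (𝓝[≠] 0) Filter.atTop :=
    Filter.tendsto_atTop_add_const_right _ _
      (tendsto_norm_cobounded_atTop.comp Filter.tendsto_inv₀_nhdsNE_zero)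
  refine Filter.tendsto_atTop_mono' _ ?_ h1
  have h2 : ∀ᶠ z : ℂ in 𝓝[≠] 0, ‖z‖ < 1 := by
    refine nhdsWithin_le_nhds ?_
    filter_upwards [Metric.ball_mem_nhds (0 : ℂ) one_pos] with z hz using mem_ball_zero_iff.1 hz
  filter_upwards [h2] with z hz
  have := norm_sub_norm_le z⁻¹ (-z)
  rw [norm_neg, sub_neg_eq_add, add_comm z⁻¹] at this
  linarith

variable {g : ℂ → ℂ}

theorem differentiableAt_of_notMem (hg : DifferentiableOn ℂ g cutSegmentᶜ) {w : ℂ}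
    (hw : w ∉ cutSegment) : DifferentiableAt ℂ g w :=
  hg.differentiableAt (isClosed_cutSegment.isOpen_compl.mem_nhds hw)

theorem differentiableOn_diskPullback (hg : DifferentiableOn ℂ g cutSegmentᶜ)
    (hlim : Filter.Tendsto g (Bornology.cobounded ℂ) (𝓝 1)) :
    DifferentiableOn ℂ (diskPullback g) (Metric.ball 0 1) := by
  rw [← Complex.differentiableOn_compl_singleton_and_continuousAt_iff
    (Metric.ball_mem_nhds (0 : ℂ) one_pos)]
  constructor
  · intro z hz
    have hz0 : z ≠ 0 := hz.2
    refine DifferentiableAt.differentiableWithinAt ?_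
    have h1 : DifferentiableAt ℂ (fun z : ℂ => g (z + z⁻¹)) z :=
      DifferentiableAt.comp z (differentiableAt_of_notMem hg
        (joukowski_notMem_cutSegment hz0 (mem_ball_zero_iff.1 hz.1)))
        (differentiableAt_id.add (differentiableAt_inv hz0))
    refine h1.congr_of_eventuallyEq ?_
    filter_upwards [isOpen_ne.mem_nhds hz0] with w hw
    exact if_neg hw
  · rw [continuousAt_iff_punctured_nhds]
    have h0 : diskPullback g 0 = 1 := if_pos rfl
    rw [h0]
    refine (hlim.comp tendsto_joukowski_cobounded).congr' ?_
    filter_upwards [self_mem_nhdsWithin] with w hw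
    exact (if_neg hw).symm

theorem IsDiskMap.differentiableOn_comp {Z : ℂ → ℂ} (hZ : IsDiskMap Z)
    (hg : DifferentiableOn ℂ g cutSegmentᶜ)
    (hlim : Filter.Tendsto g (Bornology.cobounded ℂ) (𝓝 1)) :
    DifferentiableOn ℂ (fun ζ => diskPullback g (Z ζ)) (Metric.ball 0 1) :=
  (differentiableOn_diskPullback hg hlim).comp hZ.differentiableOn fun ζ hζ =>
    mem_ball_zero_iff.2 (hZ.norm_lt_one ζ (mem_ball_zero_iff.1 hζ))

/-- Composition multiplies the order by a local degree that is at least one. Only this inequality is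
needed, so `Z` need not be injective. -/
theorem IsDiskMap.analyticOrderAt_le {Z : ℂ → ℂ} (hZ : IsDiskMap Z)
    (hg : DifferentiableOn ℂ g cutSegmentᶜ) {ζ : ℂ} (hζ0 : ζ ≠ 0) (hζ : ‖ζ‖ < 1) :
    analyticOrderAt g (Z ζ + (Z ζ)⁻¹)
      ≤ analyticOrderAt (fun ζ => diskPullback g (Z ζ)) ζ := by
  have hnhds : Metric.ball (0 : ℂ) 1 ∈ 𝓝 ζ :=
    Metric.isOpen_ball.mem_nhds (mem_ball_zero_iff.2 hζ)
  have hZ0 := hZ.ne_zero ζ hζ0 hζ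
  have hZa : AnalyticAt ℂ Z ζ := hZ.differentiableOn.analyticAt hnhds
  have hJ : AnalyticAt ℂ (fun ζ => Z ζ + (Z ζ)⁻¹) ζ := hZa.add (hZa.inv hZ0)
  have hga : AnalyticAt ℂ g (Z ζ + (Z ζ)⁻¹) :=
    hg.analyticAt (isClosed_cutSegment.isOpen_compl.mem_nhds
      (joukowski_notMem_cutSegment hZ0 (hZ.norm_lt_one ζ hζ)))
  have heq : (fun ζ => diskPullback g (Z ζ)) =ᶠ[𝓝 ζ] g ∘ fun ζ => Z ζ + (Z ζ)⁻¹ := by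
    filter_upwards [hnhds, isOpen_ne.mem_nhds hζ0] with w hw hw0
    exact if_neg (hZ.ne_zero w hw0 (mem_ball_zero_iff.1 hw))
  rw [analyticOrderAt_congr heq,
    AnalyticAt.analyticOrderAt_comp (g := fun ζ => Z ζ + (Z ζ)⁻¹) hga hJ]
  refine le_mul_of_one_le_right zero_le ?_
  rw [Order.one_le_iff_ne_zero, ne_eq, AnalyticAt.analyticOrderAt_eq_zero (by fun_prop)]
  simp

/-- If `K < 0`, the pullback has modulus below `1` off the origin and value `1` there, against the
maximum principle. -/
theorem nonneg_of_log_norm_le (hg : DifferentiableOn ℂ g cutSegmentᶜ)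
    (hlim : Filter.Tendsto g (Bornology.cobounded ℂ) (𝓝 1)) {α β K : ℝ}
    (hb : ∀ z : ℂ, z ∉ cutSegment → g z ≠ 0 →
        Real.log ‖g z‖ ≤ K / (distCut z ^ α * ‖z ^ 2 - 4‖ ^ β)) : 0 ≤ K := by
  by_contra! hK
  have hlt : ∀ z : ℂ, z ≠ 0 → ‖z‖ < 1 → ‖diskPullback g z‖ < 1 := by
    intro z hz0 hz
    rw [diskPullback, if_neg hz0]
    by_cases h0 : g (z + z⁻¹) = 0
    · rw [h0, norm_zero]; exact one_pos
    have hmem := joukowski_notMem_cutSegment hz0 hz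
    have hv := norm_inv_sub_self_pos hz0 hz
    have hd : 0 < distCut (z + z⁻¹) := by
      refine lt_of_lt_of_le ?_ (le_distCut_joukowski hz0)
      have : 0 < 1 - ‖z‖ := by linarith
      positivity
    have hn : 0 < ‖(z + z⁻¹) ^ 2 - 4‖ := by
      rw [norm_joukowski_sq_sub_four hz0]; positivity
    have hneg : K / (distCut (z + z⁻¹) ^ α * ‖(z + z⁻¹) ^ 2 - 4‖ ^ β) < 0 :=
      div_neg_of_neg_of_pos hK (by positivity)
    exact (Real.log_neg_iff (norm_pos_iff.2 h0)).1 ((hb _ hmem h0).trans_lt hneg)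
  have hd := differentiableOn_diskPullback hg hlim
  have h0 : diskPullback g 0 = 1 := if_pos rfl
  have hball := Metric.ball_mem_nhds (0 : ℂ) one_pos
  have hconst := Complex.eventually_eq_of_isLocalMax_norm (f := diskPullback g) (c := 0)
    (hd.eventually_differentiableAt hball) (by
      filter_upwards [hball] with z hz
      simp only [Function.comp_apply, h0, norm_one]
      by_cases hz0 : z = 0
      · rw [hz0, h0, norm_one]
      · exact (hlt z hz0 (mem_ball_zero_iff.1 hz)).le)
  have hne : ∀ᶠ z : ℂ in 𝓝[≠] 0, False := by
    filter_upwards [nhdsWithin_le_nhds hconst, nhdsWithin_le_nhds hball, self_mem_nhdsWithin]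
      with z h1 h2 h3
    have := hlt z h3 (mem_ball_zero_iff.1 h2)
    rw [h1, h0, norm_one] at this
    exact lt_irrefl _ this
  exact hne.exists.elim fun _ h => h

end Pullback

/-! ### Jensen's formula for the pullback -/

section Jensen

/-- Jensen's inequality for finitely many zeros, counted with multiplicity. -/
theorem sum_analyticOrderAt_mul_log_le {F : ℂ → ℂ} (hF : DifferentiableOn ℂ F (Metric.ball 0 1))
    (hF0 : F 0 = 1) {R : ℝ} (hR0 : 0 < R) (hR : R < 1) (S : Finset ℂ)
    (hS : ∀ ζ ∈ S, ζ ≠ 0 ∧ ‖ζ‖ < R) :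
    ∑ ζ ∈ S, ((analyticOrderAt F ζ : ℕ∞) : ℝ≥0∞) * ENNReal.ofReal (Real.log (R / ‖ζ‖))
      ≤ ENNReal.ofReal (Real.circleAverage (fun ζ => Real.log ‖F ζ‖) 0 R) := by
  have hball : AnalyticOnNhd ℂ F (Metric.ball 0 1) := hF.analyticOnNhd Metric.isOpen_ball
  have hcb : AnalyticOnNhd ℂ F (Metric.closedBall 0 |R|) := by
    rw [abs_of_pos hR0]; exact hball.mono (Metric.closedBall_subset_ball hR)
  have hJ := hcb.circleAverage_log_norm hR0.ne' (by rw [hF0]; exact one_ne_zero)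
  rw [hF0, norm_one, Real.log_one, add_zero] at hJ
  set D := MeromorphicOn.divisor F (Metric.closedBall 0 |R|) with hD
  set f : ℂ → ℝ := fun u => D u * Real.log (R * ‖0 - u‖⁻¹) with hf
  have hDnn : ∀ u, (0 : ℝ) ≤ D u := fun u => by
    exact_mod_cast MeromorphicOn.AnalyticOnNhd.divisor_nonneg hcb u
  have hfnn : ∀ u, 0 ≤ f u := by
    intro u
    by_cases hu : u ∈ Metric.closedBall (0 : ℂ) |R|
    · refine mul_nonneg (hDnn u) ?_
      rw [mem_closedBall_zero_iff, abs_of_pos hR0] at hu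
      rw [zero_sub, norm_neg]
      by_cases hu0 : u = 0
      · simp [hu0]
      · refine Real.log_nonneg ?_
        rw [← div_eq_mul_inv, one_le_div (norm_pos_iff.2 hu0)]
        exact hu
    · have : D u = 0 := Function.locallyFinsuppWithin.apply_eq_zero_of_notMem D hu
      simp [hf, this]
  have hterm : ∀ ζ ∈ S, ((analyticOrderAt F ζ : ℕ∞) : ℝ≥0∞) * ENNReal.ofReal (Real.log (R / ‖ζ‖))
      = ENNReal.ofReal (f ζ) := by
    intro ζ hζ
    obtain ⟨hζ0, hζR⟩ := hS ζ hζ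
    have hmem : ζ ∈ Metric.closedBall (0 : ℂ) |R| := by
      rw [mem_closedBall_zero_iff, abs_of_pos hR0]; exact hζR.le
    -- A zero of infinite order would force `F = 0` on the disc, against `F 0 = 1`.
    have hfin : analyticOrderAt F ζ ≠ ⊤ := by
      intro htop
      rw [analyticOrderAt_eq_top] at htop
      have := hball.eqOn_zero_of_preconnected_of_eventuallyEq_zero
        (convex_ball (0 : ℂ) 1).isPreconnected (mem_ball_zero_iff.2 (hζR.trans hR)) htop
        (Metric.mem_ball_self one_pos)
      rw [hF0] at this
      exact one_ne_zero this
    obtain ⟨n, hn⟩ := ENat.ne_top_iff_exists.1 hfin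
    have hDn : D ζ = n := by
      rw [hD, MeromorphicOn.AnalyticOnNhd.divisor_apply hcb hmem, ← hn]; simp
    rw [hf, ← hn, ENat.toENNReal_coe]
    simp only [hDn]
    rw [ENNReal.ofReal_mul (by positivity), zero_sub, norm_neg, div_eq_mul_inv]
    simp
  rw [Finset.sum_congr rfl hterm, ← ENNReal.ofReal_sum_of_nonneg fun u _ => hfnn u]
  refine ENNReal.ofReal_le_ofReal ?_
  rw [hJ]
  have hfs : f.support.Finite := by
    refine (D.finiteSupport (isCompact_closedBall 0 |R|)).subset fun u hu h => hu ?_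
    simp [hf, h]
  classical
  rw [finsum_eq_sum_of_support_subset f (s := hfs.toFinset ∪ S) (by
    intro u hu; simp [hu])]
  exact Finset.sum_le_sum_of_subset_of_nonneg Finset.subset_union_right fun u _ _ => hfnn u

variable {g : ℂ → ℂ}

theorem tsum_analyticOrderAt_mul_le {Z : ℂ → ℂ} (hZ : IsDiskMap Z)
    (hg : DifferentiableOn ℂ g cutSegmentᶜ)
    (hlim : Filter.Tendsto g (Bornology.cobounded ℂ) (𝓝 1)) {R : ℝ} (hR0 : 0 < R) (hR : R < 1)
    (G : {z : ℂ // z ∉ cutSegment ∧ g z = 0} → ℝ≥0∞)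
    (hG : ∀ w, G w = 0 ∨ ∃ ζ : ℂ, ζ ≠ 0 ∧ ‖ζ‖ < R ∧ Z ζ + (Z ζ)⁻¹ = w ∧
      G w ≤ ENNReal.ofReal (Real.log (R / ‖ζ‖))) :
    ∑' w : {z : ℂ // z ∉ cutSegment ∧ g z = 0},
      ((analyticOrderAt g (w : ℂ) : ℕ∞) : ℝ≥0∞) * G w
      ≤ ENNReal.ofReal (Real.circleAverage (fun ζ => Real.log ‖diskPullback g (Z ζ)‖) 0 R) := by
  classical
  have hF0 : diskPullback g (Z 0) = 1 := by rw [hZ.map_zero]; exact if_pos rfl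
  have hchoice : ∀ w, ∃ ζ : ℂ, G w ≠ 0 → (ζ ≠ 0 ∧ ‖ζ‖ < R ∧ Z ζ + (Z ζ)⁻¹ = w ∧
      G w ≤ ENNReal.ofReal (Real.log (R / ‖ζ‖))) := by
    intro w
    rcases hG w with h | ⟨ζ, h⟩
    · exact ⟨0, fun h' => absurd h h'⟩
    · exact ⟨ζ, fun _ => h⟩
  choose ζ hζ using hchoice
  rw [ENNReal.tsum_eq_iSup_sum]
  refine iSup_le fun T => ?_
  set T' := T.filter fun w => G w ≠ 0 with hT'
  have hmem : ∀ w ∈ T', G w ≠ 0 := fun w hw => (Finset.mem_filter.1 hw).2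
  have hinj : Set.InjOn ζ T' := by
    intro w hw w' hw' h
    have h1 := (hζ w (hmem w hw)).2.2.1
    have h2 := (hζ w' (hmem w' hw')).2.2.1
    rw [h, h2] at h1
    exact Subtype.ext h1.symm
  calc ∑ w ∈ T, ((analyticOrderAt g (w : ℂ) : ℕ∞) : ℝ≥0∞) * G w
      = ∑ w ∈ T', ((analyticOrderAt g (w : ℂ) : ℕ∞) : ℝ≥0∞) * G w := by
        rw [hT', Finset.sum_filter]
        refine Finset.sum_congr rfl fun w _ => ?_
        by_cases h : G w = 0 <;> simp [h]
    _ ≤ ∑ w ∈ T', ((analyticOrderAt (fun ζ => diskPullback g (Z ζ)) (ζ w) : ℕ∞) : ℝ≥0∞)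
          * ENNReal.ofReal (Real.log (R / ‖ζ w‖)) := by
        refine Finset.sum_le_sum fun w hw => ?_
        obtain ⟨h0, h1, h2, h3⟩ := hζ w (hmem w hw)
        refine mul_le_mul' ?_ h3
        rw [← h2]
        exact ENat.toENNReal_le.2 (hZ.analyticOrderAt_le hg h0 (h1.trans hR))
    _ = ∑ u ∈ T'.image ζ, ((analyticOrderAt (fun ζ => diskPullback g (Z ζ)) u : ℕ∞) : ℝ≥0∞)
          * ENNReal.ofReal (Real.log (R / ‖u‖)) := by
        rw [Finset.sum_image hinj]
    _ ≤ _ := by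
        refine sum_analyticOrderAt_mul_log_le (hZ.differentiableOn_comp hg hlim) hF0 hR0 hR _ ?_
        intro u hu
        obtain ⟨w, hw, rfl⟩ := Finset.mem_image.1 hu
        exact ⟨(hζ w (hmem w hw)).1, (hζ w (hmem w hw)).2.1⟩

theorem circleAverage_log_norm_diskPullback_le {Z : ℂ → ℂ} (hZ : IsDiskMap Z)
    (hg : DifferentiableOn ℂ g cutSegmentᶜ)
    (hlim : Filter.Tendsto g (Bornology.cobounded ℂ) (𝓝 1)) {α β K : ℝ} (hK : 0 ≤ K)
    (hb : ∀ z : ℂ, z ∉ cutSegment → g z ≠ 0 →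
        Real.log ‖g z‖ ≤ K / (distCut z ^ α * ‖z ^ 2 - 4‖ ^ β))
    {R : ℝ} (hR0 : 0 < R) (hR : R < 1) {B : ℂ → ℝ} (hB : CircleIntegrable B 0 R)
    (hle : ∀ ζ : ℂ, ‖ζ‖ = R →
      (distCut (Z ζ + (Z ζ)⁻¹) ^ α * ‖(Z ζ + (Z ζ)⁻¹) ^ 2 - 4‖ ^ β)⁻¹ ≤ B ζ) :
    Real.circleAverage (fun ζ => Real.log ‖diskPullback g (Z ζ)‖) 0 R
      ≤ K * Real.circleAverage B 0 R := by
  rw [← smul_eq_mul, ← Real.circleAverage_fun_smul]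
  have hsub : Metric.sphere (0 : ℂ) R ⊆ Metric.ball 0 1 :=
    Metric.sphere_subset_closedBall.trans (Metric.closedBall_subset_ball hR)
  refine Real.circleAverage_mono ?_ (IntervalIntegrable.const_mul hB K) ?_
  · refine MeromorphicOn.circleIntegrable_log_norm_of_nonneg ?_ hR0.le
    exact (((hZ.differentiableOn_comp hg hlim).analyticOnNhd Metric.isOpen_ball).mono
      hsub).meromorphicOn
  · intro ζ hζ
    rw [abs_of_pos hR0, mem_sphere_zero_iff_norm] at hζ
    have hζ0 : ζ ≠ 0 := norm_pos_iff.1 (by rw [hζ]; exact hR0)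
    have hζ1 : ‖ζ‖ < 1 := by rw [hζ]; exact hR
    have hZ0 := hZ.ne_zero ζ hζ0 hζ1
    have hmem := joukowski_notMem_cutSegment hZ0 (hZ.norm_lt_one ζ hζ1)
    have hmaj : K / (distCut (Z ζ + (Z ζ)⁻¹) ^ α * ‖(Z ζ + (Z ζ)⁻¹) ^ 2 - 4‖ ^ β)
        ≤ K * B ζ := by
      rw [div_eq_mul_inv]
      exact mul_le_mul_of_nonneg_left (hle ζ hζ) hK
    rw [smul_eq_mul, diskPullback, if_neg hZ0]
    by_cases h0 : g (Z ζ + (Z ζ)⁻¹) = 0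
    -- At a zero `Real.log 0 = 0`, so the majorant must be nonnegative: this is where `0 ≤ K`
    -- enters.
    · rw [h0, norm_zero, Real.log_zero]
      refine le_trans ?_ hmaj
      have : 0 ≤ distCut (Z ζ + (Z ζ)⁻¹) := Metric.infDist_nonneg
      positivity
    · exact (hb _ hmem h0).trans hmaj

end Jensen

/-! ### Dyadic decomposition of the zeros -/

section Assembly

variable {g : ℂ → ℂ}

/-- Each zero is charged to a single index `i`, and Jensen is applied once per index. -/
theorem tsum_analyticOrderAt_mul_le_tsum {ι : Type*} (hg : DifferentiableOn ℂ g cutSegmentᶜ)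
    (hlim : Filter.Tendsto g (Bornology.cobounded ℂ) (𝓝 1)) (Z : ι → ℂ → ℂ)
    (hZ : ∀ i, IsDiskMap (Z i)) (R c A : ι → ℝ) (hR0 : ∀ i, 0 < R i) (hR : ∀ i, R i < 1)
    (hc : ∀ i, 0 ≤ c i)
    (hA : ∀ i, Real.circleAverage (fun ζ => Real.log ‖diskPullback g (Z i ζ)‖) 0 (R i) ≤ A i)
    (W : {z : ℂ // z ∉ cutSegment ∧ g z = 0} → ℝ)
    (hW : ∀ w : {z : ℂ // z ∉ cutSegment ∧ g z = 0}, ∃ i, ∃ ζ : ℂ,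
      ζ ≠ 0 ∧ ‖ζ‖ < R i ∧ Z i ζ + (Z i ζ)⁻¹ = w ∧ W w ≤ c i * Real.log (R i / ‖ζ‖)) :
    ∑' w : {z : ℂ // z ∉ cutSegment ∧ g z = 0},
      ((analyticOrderAt g (w : ℂ) : ℕ∞) : ℝ≥0∞) * ENNReal.ofReal (W w)
      ≤ ∑' i, ENNReal.ofReal (c i * A i) := by
  classical
  choose i ζ h0 hlt heq hle using hW
  set G : ι → {z : ℂ // z ∉ cutSegment ∧ g z = 0} → ℝ≥0∞ := fun k w =>
    if i w = k then ENNReal.ofReal (Real.log (R k / ‖ζ w‖)) else 0 with hG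
  calc ∑' w : {z : ℂ // z ∉ cutSegment ∧ g z = 0},
      ((analyticOrderAt g (w : ℂ) : ℕ∞) : ℝ≥0∞) * ENNReal.ofReal (W w)
      ≤ ∑' w : {z : ℂ // z ∉ cutSegment ∧ g z = 0}, ∑' k, ENNReal.ofReal (c k) *
        (((analyticOrderAt g (w : ℂ) : ℕ∞) : ℝ≥0∞) * G k w) := by
        refine ENNReal.tsum_le_tsum fun w => ?_
        refine le_trans ?_ (ENNReal.le_tsum (i w))
        simp only [hG, if_true]
        rw [mul_left_comm, ← ENNReal.ofReal_mul (hc _)]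
        gcongr
        exact hle w
    _ = ∑' k, ENNReal.ofReal (c k) * ∑' w : {z : ℂ // z ∉ cutSegment ∧ g z = 0},
        ((analyticOrderAt g (w : ℂ) : ℕ∞) : ℝ≥0∞) * G k w := by
        rw [ENNReal.tsum_comm]
        exact tsum_congr fun k => ENNReal.tsum_mul_left
    _ ≤ _ := by
        refine ENNReal.tsum_le_tsum fun k => ?_
        rw [ENNReal.ofReal_mul (hc k)]
        gcongr
        refine (tsum_analyticOrderAt_mul_le (hZ k) hg hlim (hR0 k) (hR k) (G k) ?_).trans
          (ENNReal.ofReal_le_ofReal (hA k))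
        intro w
        by_cases hk : i w = k
        · right
          subst hk
          exact ⟨ζ w, h0 w, hlt w, heq w, by simp [hG]⟩
        · left; simp [hG, hk]

theorem sub_le_log_div {x R : ℝ} (hx : 0 < x) (hR : R ≤ 1) (hxR : x < R) :
    R - x ≤ Real.log (R / x) := by
  have hR0 : 0 < R := hx.trans hxR
  refine le_trans ?_ (Real.one_sub_inv_le_log_of_pos (div_pos hR0 hx))
  rw [inv_div, one_sub_div hR0.ne', le_div_iff₀ hR0]
  nlinarith

theorem exists_half_pow {x : ℝ} (hx : 0 < x) (hx1 : x ≤ 1) :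
    ∃ n : ℕ, (1 / 2 : ℝ) ^ (n + 1) < x ∧ x ≤ 2 * (1 / 2 : ℝ) ^ (n + 1) := by
  obtain ⟨n, h1, h2⟩ := exists_nat_pow_near_of_lt_one hx hx1 (by norm_num : (0:ℝ) < 1 / 2)
    (by norm_num)
  exact ⟨n, h1, h2.trans_eq (by ring)⟩

theorem summable_half_pow_rpow {x : ℝ} (hx : 0 < x) :
    Summable fun n : ℕ => ((1 / 2 : ℝ) ^ n) ^ x := by
  have h : (fun n : ℕ => ((1 / 2 : ℝ) ^ n) ^ x) = fun n : ℕ => ((1 / 2 : ℝ) ^ x) ^ n := by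
    funext n
    rw [← Real.rpow_natCast, ← Real.rpow_natCast, ← Real.rpow_mul (by norm_num),
      ← Real.rpow_mul (by norm_num), mul_comm]
  rw [h]
  exact summable_geometric_of_lt_one (by positivity)
    (Real.rpow_lt_one (by norm_num) (by norm_num) hx)

theorem one_sub_norm_sq_div_le {z : ℂ} (hz : z ≠ 0) :
    (1 - ‖z‖ ^ 2) / ‖z‖ ≤ ‖z⁻¹ - z‖ := by
  rw [inv_sub_self_eq hz, norm_div]
  gcongr
  exact one_sub_sq_le_norm z

theorem norm_inv_sub_le {z : ℂ} (hz1 : ‖z‖ < 1) (hz : z ≠ 0) : ‖z⁻¹ - z‖ ≤ 2 / ‖z‖ := by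
  have hq : 0 < ‖z‖ := norm_pos_iff.2 hz
  have h1 : ‖z‖ ≤ 1 / ‖z‖ := by
    rw [le_div_iff₀ hq]; nlinarith
  calc ‖z⁻¹ - z‖ ≤ ‖z⁻¹‖ + ‖z‖ := norm_sub_le _ _
    _ ≤ 1 / ‖z‖ + 1 / ‖z‖ := by rw [norm_inv, ← one_div]; gcongr
    _ = 2 / ‖z‖ := by ring

theorem weight_eq {z : ℂ} (hz : z ≠ 0) (η b : ℝ) :
    distCut (z + z⁻¹) ^ η / ‖(z + z⁻¹) ^ 2 - 4‖ ^ ((η - b) / 2)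
      = distCut (z + z⁻¹) ^ η / ‖z⁻¹ - z‖ ^ (η - b) := by
  rw [norm_joukowski_sq_sub_four hz, ← Real.rpow_natCast ‖z⁻¹ - z‖ 2,
    ← Real.rpow_mul (norm_nonneg _)]
  congr 2; push_cast; ring

theorem weight_le_of_distCut_le {z : ℂ} (hz : z ≠ 0) (hz1 : ‖z‖ < 1) {η b δ : ℝ} (hη : 0 ≤ η)
    (hδ : 0 ≤ δ) (hd : distCut (z + z⁻¹) ≤ δ * ‖z⁻¹ - z‖) :
    distCut (z + z⁻¹) ^ η / ‖(z + z⁻¹) ^ 2 - 4‖ ^ ((η - b) / 2) ≤ δ ^ η * ‖z⁻¹ - z‖ ^ b := by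
  have hv := norm_inv_sub_self_pos hz hz1
  rw [weight_eq hz, div_le_iff₀ (by positivity), mul_assoc, ← Real.rpow_add hv,
    add_sub_cancel, ← Real.mul_rpow hδ hv.le]
  exact Real.rpow_le_rpow Metric.infDist_nonneg hd hη

/-- The exponent `b = max (γ - 1 + τ) 0` leaves `0 ≤ γ - b ≤ 1 - τ < 1`: the factor `r ^ (-b)` is
paid for with `r ≥ s`, and the rest has an integrable singularity at `ζ = ±1`. -/
theorem rpow_neg_le_mul_re_cpow {γ τ s r : ℝ} (hγ : 0 ≤ γ) (hτ₀ : 0 < τ) (hτ₁ : τ < 1)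
    (hs : 0 < s) (hsr : s ≤ r) {ζ : ℂ} (hζ : ‖ζ‖ < 1) (hζr : ‖1 - ζ ^ 2‖ / 2 ≤ r) :
    r ^ (-γ) ≤ s ^ (-(max (γ - 1 + τ) 0)) * (2 / Real.cos ((1 - τ) * (Real.pi / 2)))
      * ((1 - ζ ^ 2) ^ ((-(1 - τ) : ℝ) : ℂ)).re := by
  set b := max (γ - 1 + τ) 0 with hb
  have hr : 0 < r := hs.trans_le hsr
  have hb0 : 0 ≤ b := le_max_right _ _
  have hbγ : γ - b ≤ 1 - τ := by linarith [le_max_left (γ - 1 + τ) 0]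
  have hb2 : 0 ≤ γ - b := by
    have : b ≤ γ := max_le (by linarith) hγ
    linarith
  set x := ‖1 - ζ ^ 2‖ with hx
  have hx0 : 0 < x := norm_pos_iff.2 (one_sub_sq_ne_zero hζ)
  have hx2 : x / 2 ≤ 1 := by
    have : x ≤ ‖(1 : ℂ)‖ + ‖ζ ^ 2‖ := norm_sub_le _ _
    rw [norm_one] at this
    linarith [norm_sq_lt_one hζ]
  have hκ : 0 < Real.cos ((1 - τ) * (Real.pi / 2)) := by
    refine Real.cos_pos_of_mem_Ioo ⟨?_, ?_⟩ <;> nlinarith [Real.pi_pos]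
  have h1 : r ^ (-b) ≤ s ^ (-b) := Real.rpow_le_rpow_of_nonpos hs hsr (by linarith)
  have h2 : r ^ (-(γ - b)) ≤ (x / 2) ^ (-(γ - b)) :=
    Real.rpow_le_rpow_of_nonpos (by positivity) hζr (by linarith)
  have h3 : (x / 2) ^ (-(γ - b)) ≤ (x / 2) ^ (-(1 - τ)) :=
    Real.rpow_le_rpow_of_exponent_ge (by positivity) hx2 (by linarith)
  have h4 : (x / 2) ^ (-(1 - τ)) ≤ 2 * x ^ (-(1 - τ)) := by
    rw [Real.div_rpow hx0.le (by norm_num), div_eq_mul_inv, mul_comm,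
      ← Real.rpow_neg (by norm_num), neg_neg]
    gcongr
    calc (2 : ℝ) ^ (1 - τ) ≤ 2 ^ (1 : ℝ) :=
          Real.rpow_le_rpow_of_exponent_le (by norm_num) (by linarith)
      _ = 2 := Real.rpow_one 2
  have h5 := norm_rpow_neg_le_re_cpow (ρ := 1 - τ) (by linarith) (by linarith)
    (re_one_sub_sq_pos hζ)
  rw [← hx, ← le_div_iff₀ hκ] at h5
  calc r ^ (-γ) = r ^ (-b) * r ^ (-(γ - b)) := by
        rw [← Real.rpow_add hr]; congr 1; ring
    _ ≤ s ^ (-b) * (2 * (((1 - ζ ^ 2) ^ ((-(1 - τ) : ℝ) : ℂ)).re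
          / Real.cos ((1 - τ) * (Real.pi / 2)))) := by
        refine mul_le_mul h1 (h2.trans (h3.trans (h4.trans ?_))) (by positivity) (by positivity)
        gcongr
    _ = _ := by ring

theorem circleAverage_dumbbellMap_le (hg : DifferentiableOn ℂ g cutSegmentᶜ)
    (hlim : Filter.Tendsto g (Bornology.cobounded ℂ) (𝓝 1)) {α β τ K : ℝ} (hα : 0 ≤ α)
    (hβ : 0 ≤ β) (hτ₀ : 0 < τ) (hτ₁ : τ < 1) (hK : 0 ≤ K)
    (hb : ∀ z : ℂ, z ∉ cutSegment → g z ≠ 0 →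
        Real.log ‖g z‖ ≤ K / (distCut z ^ α * ‖z ^ 2 - 4‖ ^ β))
    {ε s : ℝ} (hε : 0 < ε) (hε1 : ε < 1) (hs : 0 < s) (hs1 : s ≤ 1) :
    Real.circleAverage (fun ζ => Real.log ‖diskPullback g (dumbbellMap s ζ)‖) 0 (1 - ε)
      ≤ K * ((2 / ε) ^ α * (s ^ (-(max (α + 2 * β - 1 + τ) 0))
        * (2 / Real.cos ((1 - τ) * (Real.pi / 2))))) := by
  have hR0 : 0 < 1 - ε := by linarith
  obtain ⟨hi, ha⟩ := circleAverage_re_one_sub_sq_cpow hR0 (by linarith) (-(1 - τ))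
  set c := (2 / ε) ^ α * (s ^ (-(max (α + 2 * β - 1 + τ) 0))
        * (2 / Real.cos ((1 - τ) * (Real.pi / 2)))) with hc
  have hi' : CircleIntegrable (fun ζ : ℂ => c * ((1 - ζ ^ 2) ^ ((-(1 - τ) : ℝ) : ℂ)).re) 0 (1 - ε) :=
    IntervalIntegrable.const_mul hi c
  have h := circleAverage_log_norm_diskPullback_le (isDiskMap_dumbbellMap hs hs1) hg hlim hK hb
    hR0 (by linarith) (B := fun ζ => c * ((1 - ζ ^ 2) ^ ((-(1 - τ) : ℝ) : ℂ)).re)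
    hi' ?_
  · refine h.trans_eq ?_
    have h2 := Real.circleAverage_fun_smul (a := c) (c := 0) (R := 1 - ε)
      (f := fun ζ : ℂ => ((1 - ζ ^ 2) ^ ((-(1 - τ) : ℝ) : ℂ)).re)
    simp only [smul_eq_mul] at h2
    rw [h2, ha, mul_one]
  · intro ζ hζ
    have hζ1 : ‖ζ‖ < 1 := by linarith
    have hζ0 : ζ ≠ 0 := norm_pos_iff.1 (by rw [hζ]; exact hR0)
    obtain ⟨h1, h2⟩ := dumbbellMap_norm_bounds hs hs1 hζ0 hζ1
    refine (inv_majorant_le hα hε (dumbbellMap_ne_zero hs hs1 hζ0 hζ1)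
      ((norm_dumbbellMap_le hs hs1 hζ1).trans hζ.le)).trans ?_
    rw [hc, mul_assoc]
    refine mul_le_mul_of_nonneg_left ?_ (by positivity)
    exact rpow_neg_le_mul_re_cpow (by positivity) hτ₀ hτ₁ hs h1 hζ1 h2

theorem circleAverage_diskPullback_le (hg : DifferentiableOn ℂ g cutSegmentᶜ)
    (hlim : Filter.Tendsto g (Bornology.cobounded ℂ) (𝓝 1)) {α β K : ℝ} (hα : 0 ≤ α)
    (hβ : 0 ≤ β) (hK : 0 ≤ K)
    (hb : ∀ z : ℂ, z ∉ cutSegment → g z ≠ 0 →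
        Real.log ‖g z‖ ≤ K / (distCut z ^ α * ‖z ^ 2 - 4‖ ^ β))
    {u : ℝ} (hu : 0 < u) (hu1 : u ≤ 1) :
    Real.circleAverage (fun ζ => Real.log ‖diskPullback g ζ‖) 0 (3 / 4 * u)
      ≤ K * (8 ^ α * (2 * u) ^ (α + 2 * β)) := by
  have h := circleAverage_log_norm_diskPullback_le isDiskMap_id hg hlim hK hb
    (R := 3 / 4 * u) (by positivity) (by linarith)
    (B := fun _ => 8 ^ α * (2 * u) ^ (α + 2 * β)) (circleIntegrable_const _ _ _) ?_
  · rwa [Real.circleAverage_const] at h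
  · intro ζ hζ
    have hζ0 : ζ ≠ 0 := norm_pos_iff.1 (by rw [hζ]; positivity)
    have hζ1 : ‖ζ‖ < 1 := by linarith
    refine (inv_majorant_le hα (ε := 1 / 4) (by norm_num) hζ0 (by linarith)).trans ?_
    rw [show (2 : ℝ) / (1 / 4) = 8 by norm_num]
    refine mul_le_mul_of_nonneg_left ?_ (by positivity)
    have h1 : (2 * u)⁻¹ ≤ ‖ζ⁻¹ - ζ‖ := by
      refine le_trans ?_ (one_sub_norm_sq_div_le hζ0)
      rw [hζ, inv_eq_one_div, div_le_div_iff₀ (by positivity) (by positivity)]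
      nlinarith
    refine (Real.rpow_le_rpow_of_nonpos (by positivity) h1 ?_).trans_eq ?_
    · have : 0 ≤ α + 2 * β := by positivity
      linarith
    · rw [Real.rpow_neg (by positivity), Real.inv_rpow (by positivity), inv_inv]

/-- Zeros close to the cut lie well inside one of the dumbbell domains. -/
theorem weight_le_of_near {α b τ : ℝ} (hα : 0 ≤ α) (hb : 0 ≤ b) (hτ₀ : 0 < τ) {z : ℂ}
    (hz1 : ‖z‖ < 1) (hz2 : 1 / 2 < ‖z‖) :
    ∃ j k : ℕ, ∃ ζ : ℂ, ζ ≠ 0 ∧ ‖ζ‖ < 1 - (1 / 2) ^ (j + 1) ∧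
      dumbbellMap ((1 / 2) ^ (k + 1)) ζ = z ∧
      distCut (z + z⁻¹) ^ (α + 1 + τ) / ‖(z + z⁻¹) ^ 2 - 4‖ ^ ((α + 1 + τ - b) / 2)
        ≤ 2 ^ (α + 1 + τ) * 16 ^ (α + τ / 2) * 16 ^ (b + τ / 2) * 8
          * ((1 / 2) ^ (j + 1)) ^ (α + τ / 2) * ((1 / 2) ^ (k + 1)) ^ (b + τ / 2)
          * Real.log ((1 - (1 / 2) ^ (j + 1)) / ‖ζ‖) := by
  have hq : 0 < ‖z‖ := by linarith
  have hz0 : z ≠ 0 := norm_pos_iff.1 hq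
  have hr0 := norm_inv_sub_self_pos hz0 hz1
  have hr4 : ‖z⁻¹ - z‖ ≤ 4 := by
    refine (norm_inv_sub_le hz1 hz0).trans ?_
    rw [div_le_iff₀ hq]; linarith
  have hdr : 1 - ‖z‖ ≤ ‖z⁻¹ - z‖ := by
    refine le_trans ?_ (one_sub_norm_sq_div_le hz0)
    rw [le_div_iff₀ hq]; nlinarith
  have hd0 : 0 < 1 - ‖z‖ := by linarith
  have hW := weight_le_of_distCut_le hz0 hz1 (η := α + 1 + τ) (b := b) (δ := 2 * (1 - ‖z‖))
    (by positivity) (by positivity) (distCut_joukowski_le_mul hz0 hz1)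
  -- With `d = 1 - |z|` and `r = |v|`, this gives `8ε < d ≤ 16ε` and `8s < r ≤ 16s`. Then `1 - |ζ| ≥
  -- d/4` exceeds `ε` by at least `d/8`, the source of the factor `8` before the logarithm.
  obtain ⟨j, hj1, hj2⟩ := exists_half_pow (x := (1 - ‖z‖) / 8) (by positivity) (by linarith)
  obtain ⟨k, hk1, hk2⟩ := exists_half_pow (x := ‖z⁻¹ - z‖ / 8) (by positivity) (by linarith)
  have hs1 : (1 / 2 : ℝ) ^ (k + 1) ≤ 1 := pow_le_one₀ (by norm_num) (by norm_num)
  have hs0 : (0 : ℝ) < (1 / 2) ^ (k + 1) := by positivity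
  have hε0 : (0 : ℝ) < (1 / 2) ^ (j + 1) := by positivity
  set s : ℝ := (1 / 2) ^ (k + 1)
  set ε : ℝ := (1 / 2) ^ (j + 1)
  set d := 1 - ‖z‖ with hd
  set r := ‖z⁻¹ - z‖
  obtain ⟨ζ, hζ0, hζ1, hζz, hζd⟩ :=
    exists_dumbbellMap_eq hs0 hs1 hz1 hz2.le (by linarith : 8 * s ≤ r)
  have hlt : ‖ζ‖ < 1 - ε := by linarith
  refine ⟨j, k, ζ, hζ0, hlt, hζz, hW.trans ?_⟩
  have hlog : d ≤ 8 * Real.log ((1 - ε) / ‖ζ‖) := by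
    have := sub_le_log_div (norm_pos_iff.2 hζ0) (by linarith) hlt
    linarith
  have e1 : d ^ (α + 1 + τ) = d ^ (α + τ / 2) * d ^ (τ / 2) * d := by
    rw [← Real.rpow_add hd0]
    nth_rewrite 3 [← Real.rpow_one d]
    rw [← Real.rpow_add hd0]; congr 1; ring
  have e2 : d ^ (α + τ / 2) ≤ 16 ^ (α + τ / 2) * ε ^ (α + τ / 2) := by
    rw [← Real.mul_rpow (by norm_num) hε0.le]
    exact Real.rpow_le_rpow hd0.le (by linarith) (by positivity)
  -- Because `d ≤ r`, half of the spare exponent `τ` can be moved from `ε` to `s`, so that both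
  -- dyadic sums converge.
  have e3 : d ^ (τ / 2) * r ^ b ≤ 16 ^ (b + τ / 2) * s ^ (b + τ / 2) := by
    rw [← Real.mul_rpow (by norm_num) hs0.le]
    calc d ^ (τ / 2) * r ^ b ≤ r ^ (τ / 2) * r ^ b := by gcongr
      _ = r ^ (b + τ / 2) := by rw [← Real.rpow_add hr0, add_comm]
      _ ≤ _ := Real.rpow_le_rpow hr0.le (by linarith) (by positivity)
  rw [Real.mul_rpow (by norm_num) hd0.le, e1]
  calc 2 ^ (α + 1 + τ) * (d ^ (α + τ / 2) * d ^ (τ / 2) * d) * r ^ b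
      = 2 ^ (α + 1 + τ) * (d ^ (α + τ / 2) * (d ^ (τ / 2) * r ^ b) * d) := by ring
    _ ≤ 2 ^ (α + 1 + τ) * ((16 ^ (α + τ / 2) * ε ^ (α + τ / 2))
          * (16 ^ (b + τ / 2) * s ^ (b + τ / 2)) * (8 * Real.log ((1 - ε) / ‖ζ‖))) := by
        gcongr
    _ = _ := by ring

/-- Zeros far from the cut lie well inside one of the discs of radius `3 / 4 * 2⁻ⁿ`. -/
theorem weight_le_of_far {η γ τ : ℝ} (hη : 0 ≤ η) {z : ℂ} (hz0 : z ≠ 0) (hz2 : ‖z‖ ≤ 1 / 2) :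
    ∃ n : ℕ, ‖z‖ < 3 / 4 * (1 / 2) ^ n ∧
      distCut (z + z⁻¹) ^ η / ‖(z + z⁻¹) ^ 2 - 4‖ ^ ((η - max (γ - 1 + τ) 0) / 2)
        ≤ 3 * 8 ^ (max (γ - 1 + τ) 0) * ((1 / 2) ^ n) ^ (1 - τ - γ)
          * Real.log (3 / 4 * (1 / 2) ^ n / ‖z‖) := by
  have hq : 0 < ‖z‖ := norm_pos_iff.2 hz0
  have hz1 : ‖z‖ < 1 := by linarith
  have hW := weight_le_of_distCut_le hz0 hz1 (η := η) (b := max (γ - 1 + τ) 0) (δ := 1)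
    hη zero_le_one (by rw [one_mul]; exact distCut_joukowski_le hz0)
  rw [Real.one_rpow, one_mul] at hW
  have hlog : ∀ u : ℝ, 0 < u → 2 * ‖z‖ ≤ u → 1 / 3 ≤ Real.log (3 / 4 * u / ‖z‖) := by
    intro u hu h
    refine le_trans ?_ (Real.one_sub_inv_le_log_of_pos (by positivity))
    rw [inv_div, le_sub_comm, div_le_iff₀ (by positivity)]
    linarith
  rcases le_or_gt (γ - 1 + τ) 0 with hb | hb
  -- For `b = 0` the weight stays bounded as `z → 0`, so a single disc suffices.
  · refine ⟨0, by rw [pow_zero]; linarith, hW.trans ?_⟩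
    rw [max_eq_right hb, Real.rpow_zero, Real.rpow_zero, pow_zero, Real.one_rpow]
    have := hlog 1 one_pos (by linarith)
    linarith
  · rw [max_eq_left hb.le] at hW ⊢
    obtain ⟨n, hn1, hn2⟩ := exists_nat_pow_near_of_lt_one (x := 2 * ‖z‖) (by positivity)
      (by linarith) (by norm_num : (0:ℝ) < 1 / 2) (by norm_num)
    have hu : (0 : ℝ) < (1 / 2) ^ n := by positivity
    rw [pow_succ] at hn1
    set u : ℝ := (1 / 2) ^ n
    refine ⟨n, by linarith, hW.trans ?_⟩
    have h1 : ‖z⁻¹ - z‖ ≤ 8 * u⁻¹ := by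
      refine (norm_inv_sub_le hz1 hz0).trans ?_
      rw [← div_eq_mul_inv, div_le_div_iff₀ hq hu]; linarith
    have h2 : ‖z⁻¹ - z‖ ^ (γ - 1 + τ) ≤ 8 ^ (γ - 1 + τ) * u ^ (1 - τ - γ) := by
      refine (Real.rpow_le_rpow (norm_nonneg _) h1 hb.le).trans_eq ?_
      rw [Real.mul_rpow (by norm_num) (by positivity), Real.inv_rpow hu.le,
        ← Real.rpow_neg hu.le]
      congr 2; ring
    have h3 := hlog u hu hn2
    have h4 : 0 ≤ 8 ^ (γ - 1 + τ) * u ^ (1 - τ - γ) := by positivity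
    calc ‖z⁻¹ - z‖ ^ (γ - 1 + τ) ≤ 8 ^ (γ - 1 + τ) * u ^ (1 - τ - γ) * (3 * (1 / 3)) := by
          linarith
      _ ≤ 8 ^ (γ - 1 + τ) * u ^ (1 - τ - γ) * (3 * Real.log (3 / 4 * u / ‖z‖)) := by gcongr
      _ = _ := by ring

end Assembly

/-! ### Summation over the dyadic family -/

theorem mainTheorem4 (α β τ : ℝ) (hα : 0 ≤ α) (hβ : 0 ≤ β) (hτ₀ : 0 < τ) (hτ₁ : τ < 1) :
    ∃ C : ℝ, 0 < C ∧ ∀ (g : ℂ → ℂ) (K₀ : ℝ),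
      DifferentiableOn ℂ g cutSegmentᶜ →
      Filter.Tendsto g (Bornology.cobounded ℂ) (𝓝 1) →
      (∀ z : ℂ, z ∉ cutSegment → g z ≠ 0 →
        Real.log ‖g z‖ ≤ K₀ / (distCut z ^ α * ‖z ^ 2 - 4‖ ^ β)) →
      zeroSum g (etaOne α τ) (etaTwo α β τ) ≤ ENNReal.ofReal (C * K₀) := by
  have hγ : 0 ≤ α + 2 * β := by positivity
  set γ := α + 2 * β with hγdef
  set b := max (γ - 1 + τ) 0 with hbdef
  have hb0 : 0 ≤ b := le_max_right _ _
  have hη : etaTwo α β τ = b := by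
    rw [etaTwo, hbdef, hγdef]; congr 1; ring
  set κ := Real.cos ((1 - τ) * (Real.pi / 2)) with hκdef
  have hκ : 0 < κ := by
    refine Real.cos_pos_of_mem_Ioo ⟨?_, ?_⟩ <;> nlinarith [Real.pi_pos]
  set C₁ : ℝ := 2 ^ (α + 1 + τ) * 16 ^ (α + τ / 2) * 16 ^ (b + τ / 2) * 8 with hC₁
  -- Left indices are the dumbbells with `ε = 2^(-j-1)` and `s = 2^(-k-1)`, right indices the small
  -- discs. `c` compares the weight with Jensen's logarithm, and `a` bounds the circle average
  -- divided by `K`.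
  set c : (ℕ × ℕ) ⊕ ℕ → ℝ := Sum.elim
    (fun p => C₁ * ((1 / 2) ^ (p.1 + 1)) ^ (α + τ / 2) * ((1 / 2) ^ (p.2 + 1)) ^ (b + τ / 2))
    (fun n => 3 * 8 ^ b * ((1 / 2) ^ n) ^ (1 - τ - γ)) with hcdef
  set a : (ℕ × ℕ) ⊕ ℕ → ℝ := Sum.elim
    (fun p => (2 / (1 / 2) ^ (p.1 + 1)) ^ α * (((1 / 2) ^ (p.2 + 1)) ^ (-b) * (2 / κ)))
    (fun n => 8 ^ α * (2 * (1 / 2) ^ n) ^ γ) with hadef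
  have hc0 : ∀ i, 0 ≤ c i := by
    rintro (p | n) <;> simp only [hcdef, Sum.elim_inl, Sum.elim_inr] <;> positivity
  have ha0 : ∀ i, 0 ≤ a i := by
    rintro (p | n) <;> simp only [hadef, Sum.elim_inl, Sum.elim_inr] <;> positivity
  have hca0 : ∀ i, 0 ≤ c i * a i := fun i => mul_nonneg (hc0 i) (ha0 i)
  -- The powers cancel down to `ε^(τ/2) s^(τ/2)` for the dumbbells and `u^(1-τ)` for the discs, all
  -- geometric.
  have hsum : Summable fun i => c i * a i := by
    apply Summable.sum
    · have h1 : Summable fun n : ℕ => ((1 / 2 : ℝ) ^ (n + 1)) ^ (τ / 2) :=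
        (summable_nat_add_iff 1).2 (summable_half_pow_rpow (by positivity))
      have h2 := (h1.mul_of_nonneg h1 (fun n => by positivity) (fun n => by positivity)).mul_left
        (C₁ * 2 ^ α * (2 / κ))
      refine h2.congr fun p => ?_
      simp only [hcdef, hadef, Function.comp_apply, Sum.elim_inl]
      have hε : (0 : ℝ) < (1 / 2) ^ (p.1 + 1) := by positivity
      have hs : (0 : ℝ) < (1 / 2) ^ (p.2 + 1) := by positivity
      generalize (1 / 2 : ℝ) ^ (p.1 + 1) = ε at hε ⊢
      generalize (1 / 2 : ℝ) ^ (p.2 + 1) = s at hs ⊢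
      have e1 : ε ^ (α + τ / 2) * (2 / ε) ^ α = 2 ^ α * ε ^ (τ / 2) := by
        rw [Real.rpow_add hε, Real.div_rpow (by norm_num) hε.le]
        field_simp
      have e2 : s ^ (b + τ / 2) * s ^ (-b) = s ^ (τ / 2) := by
        rw [← Real.rpow_add hs]; congr 1; ring
      linear_combination (-(C₁ * (2 / κ) * (s ^ (b + τ / 2) * s ^ (-b)))) * e1
        - C₁ * (2 / κ) * (2 ^ α * ε ^ (τ / 2)) * e2
    · have h1 := (summable_half_pow_rpow (x := 1 - τ) (by linarith)).mul_left
        (3 * 8 ^ b * 8 ^ α * 2 ^ γ)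
      refine h1.congr fun n => ?_
      simp only [hcdef, hadef, Function.comp_apply, Sum.elim_inr]
      have hu : (0 : ℝ) < (1 / 2) ^ n := by positivity
      generalize (1 / 2 : ℝ) ^ n = u at hu ⊢
      have e1 : u ^ (1 - τ - γ) * u ^ γ = u ^ (1 - τ) := by
        rw [← Real.rpow_add hu]; congr 1; ring
      rw [Real.mul_rpow (by norm_num) hu.le, ← e1]
      ring
  refine ⟨1 + ∑' i, c i * a i, add_pos_of_pos_of_nonneg one_pos (tsum_nonneg hca0), ?_⟩
  intro g K hg hlim hbound
  have hK : 0 ≤ K := nonneg_of_log_norm_le hg hlim hbound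
  have hpow : ∀ n : ℕ, (1 / 2 : ℝ) ^ n ≤ 1 := fun n => pow_le_one₀ (by norm_num) (by norm_num)
  have hpow' : ∀ n : ℕ, (1 / 2 : ℝ) ^ (n + 1) < 1 :=
    fun n => pow_lt_one₀ (by norm_num) (by norm_num) n.succ_ne_zero
  have hmain := tsum_analyticOrderAt_mul_le_tsum hg hlim
    (Z := Sum.elim (fun p => dumbbellMap ((1 / 2) ^ (p.2 + 1))) (fun _ ζ => ζ))
    (R := Sum.elim (fun p : ℕ × ℕ => 1 - (1 / 2) ^ (p.1 + 1)) (fun n : ℕ => 3 / 4 * (1 / 2) ^ n))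
    (c := c) (A := fun i => K * a i)
    (W := fun w => distCut w ^ (etaOne α τ) /
      ‖(w : ℂ) ^ 2 - 4‖ ^ ((etaOne α τ - etaTwo α β τ) / 2))
    (by
      rintro (p | n)
      · exact isDiskMap_dumbbellMap (by positivity) (hpow _)
      · exact isDiskMap_id)
    (by
      rintro (p | n)
      · exact sub_pos.2 (hpow' _)
      · simp only [Sum.elim_inr]; positivity)
    (by
      rintro (p | n)
      · exact sub_lt_self _ (by positivity)
      · simp only [Sum.elim_inr]; linarith [hpow n])
    hc0
    (by
      rintro (p | n)
      · exact circleAverage_dumbbellMap_le hg hlim hα hβ hτ₀ hτ₁ hK hbound (by positivity)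
          (hpow' _) (by positivity) (hpow _)
      · exact circleAverage_diskPullback_le hg hlim hα hβ hK hbound (by positivity) (hpow n))
    (by
      rintro ⟨w, hw, -⟩
      obtain ⟨z, hz0, hz1, rfl⟩ := exists_joukowski_eq hw
      simp only [hη, etaOne]
      rcases lt_or_ge (1 / 2) ‖z‖ with h | h
      · obtain ⟨j, k, ζ, h1, h2, h3, h4⟩ := weight_le_of_near hα hb0 hτ₀ hz1 h
        exact ⟨Sum.inl (j, k), ζ, h1, h2, by simp only [Sum.elim_inl, h3], h4⟩
      · obtain ⟨n, h1, h2⟩ := weight_le_of_far (η := α + 1 + τ) (γ := γ) (τ := τ)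
          (by positivity) hz0 h
        exact ⟨Sum.inr n, z, hz0, h1, rfl, h2⟩)
  refine hmain.trans ?_
  rw [← ENNReal.ofReal_tsum_of_nonneg]
  · refine ENNReal.ofReal_le_ofReal ?_
    have e : ∀ i, c i * (K * a i) = c i * a i * K := fun i => by ring
    rw [tsum_congr e, tsum_mul_right]
    exact mul_le_mul_of_nonneg_right (by linarith) hK
  · exact fun i => mul_nonneg (hc0 i) (mul_nonneg hK (ha0 i))
  · exact (hsum.mul_right K).congr fun i => by ring
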